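/- Let $K$ be an algebraically closed field of characteristic $0$, let $n\ge 3$ and $S=K[x_1,\dots,x_n]$. For a nonzero form $f\in S$ put $I_f=\{g\in S: g(\partial/\partial x_1,\dots,\partial/\partial x_n)f=0\}$ and $R_f=S/I_f$, a standard graded $K$-algebra. For a linear form $y=\sum_i a_ix_i$ write $\partial f/\partial y=\sum_i a_i\,\partial f/\partial x_i$, and $\partial^2 f/\partial y^2$ for the result of applying this operator twice. The rank of a quadric is the rank of its associated symmetric matrix. A graded algebra $R$ with $N=\dim_K R_1$ has a *Gröbner flag* if there are subspaces $0=V_0\subset V_1\subset\dots\subset V_N=R_1$ with $\dim_K V_i=i$ such that for every $0\le i<N$ the colon ideal $(V_i):(V_{i+1})$ equals $(V_j)$ for some $j$. The algebra $S/I$ is *G-quadratic* if, in some system of linear coordinates and for some term order, $I$ has a Gröbner basis consisting of quadrics. A cubic form $f\neq 0$ is *singular* if $f$ and all its first partial derivatives vanish at some nonzero point of $K^n$. Theorem. (1) Let $f\in S$ be a cubic form. Assume there is a linear form $y$ such that $\partial^2 f/\partial y^2=0$ and $\partial f/\partial y$ is a quadric of rank $n-1$. Then $R_f$ has a Gröbner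 flag. (2) For the generic singular cubic $f\in S$ the algebra $R_f$ is G-quadratic; that is, there is a Zariski open and dense subset of the set of singular cubics in $S$ (in the Zariski topology of the space of coefficients) such that $R_f$ is G-quadratic for every $f$ in it. -/

import Mathlib

noncomputable section

open MvPolynomial

namespace CubicInverseSystem

variable {K : Type*} [Field K] {n : ℕ}

/-- The partial derivative `∂/∂xᵢ` as a `K`-linear endomorphism of `K[x₁,…,xₙ]`. -/
def partialOp (K : Type*) [Field K] {n : ℕ} (i : Fin n) :
    Module.End K (MvPolynomial (Fin n) K) :=
  (pderiv i : Derivation K (MvPolynomial (Fin n) K) (MvPolynomial (Fin n) K)).toLinearMap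

theorem commute_partialOp (i j : Fin n) : Commute (partialOp K i) (partialOp K j) := by
  have h : ⁅(pderiv i : Derivation K (MvPolynomial (Fin n) K) (MvPolynomial (Fin n) K)),
      (pderiv j : Derivation K (MvPolynomial (Fin n) K) (MvPolynomial (Fin n) K))⁆ = 0 := by
    apply MvPolynomial.derivation_ext
    intro k
    simp [Derivation.commutator_apply, pderiv_X, Pi.single_apply, apply_ite]
  refine LinearMap.ext fun p => ?_
  have h1 := DFunLike.congr_fun h p
  rw [Derivation.commutator_apply] at h1
  exact sub_eq_zero.mp h1

theorem prod_map_partialOp_add (l : List (Fin n)) (a b : Fin n → ℕ) :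
    (l.map fun i => partialOp K i ^ (a i + b i)).prod =
      (l.map fun i => partialOp K i ^ a i).prod * (l.map fun i => partialOp K i ^ b i).prod := by
  induction l with
  | nil => simp
  | cons i l ih =>
    have hc : Commute (partialOp K i ^ b i) (l.map fun i => partialOp K i ^ a i).prod := by
      apply Commute.list_prod_right
      intro x hx
      obtain ⟨j, _, rfl⟩ := List.mem_map.mp hx
      exact (commute_partialOp i j).pow_pow _ _
    rw [List.map_cons, List.prod_cons, ih, pow_add, List.map_cons, List.prod_cons, List.map_cons,
      List.prod_cons, mul_assoc, mul_assoc, ← mul_assoc (partialOp K i ^ b i), hc.eq, mul_assoc]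

/-- The monomial operator `∂^d = ∏ᵢ (∂/∂xᵢ)^{dᵢ}`, multiplicatively in the exponent `d`. -/
def monomialOp (K : Type*) [Field K] {n : ℕ} :
    Multiplicative (Fin n →₀ ℕ) →* Module.End K (MvPolynomial (Fin n) K) where
  toFun d := ((List.finRange n).map fun i => partialOp K i ^ (d.toAdd i)).prod
  map_one' := by
    apply List.prod_eq_one
    intro x hx
    obtain ⟨i, _, rfl⟩ := List.mem_map.mp hx
    rfl
  map_mul' a b := prod_map_partialOp_add _ (fun i => a.toAdd i) (fun i => b.toAdd i)

/-- The `K`-algebra homomorphism `g ↦ g(∂/∂x₁,…,∂/∂xₙ)` from polynomials to differential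
operators with constant coefficients. For a linear form `y` and a polynomial `f`,
`diffOp y f` is `∂f/∂y` and `diffOp (y ^ 2) f` is `∂²f/∂y²`. -/
def diffOp (K : Type*) [Field K] {n : ℕ} :
    MvPolynomial (Fin n) K →ₐ[K] Module.End K (MvPolynomial (Fin n) K) :=
  AddMonoidAlgebra.lift K (Module.End K (MvPolynomial (Fin n) K)) (Fin n →₀ ℕ) (monomialOp K)

theorem diffOp_monomial (d : Fin n →₀ ℕ) (a : K) :
    diffOp K (monomial d a) = a • monomialOp K (Multiplicative.ofAdd d) :=
  AddMonoidAlgebra.lift_single _ _ _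

/-- The variable `xᵢ` acts as `∂/∂xᵢ`. -/
theorem diffOp_X (i : Fin n) : diffOp K (X i) = partialOp K i := by
  have key : ∀ l : List (Fin n), l.Nodup →
      (l.map fun j => partialOp K j ^ (Finsupp.single i 1 j)).prod =
        if i ∈ l then partialOp K i else 1 := by
    intro l hl
    induction l with
    | nil => simp
    | cons j l ih =>
      rw [List.nodup_cons] at hl
      rw [List.map_cons, List.prod_cons, ih hl.2]
      by_cases h : i = j
      · subst h
        simp [hl.1]
      · simp [h]
  rw [X, diffOp_monomial, one_smul]
  exact (key _ (List.nodup_finRange n)).trans (by simp)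

/-- `I_f = {g : g(∂/∂x₁,…,∂/∂xₙ) f = 0}`; the algebra `R_f` is the quotient of
`K[x₁,…,xₙ]` by `I_f`. -/
def inverseSystemIdeal (f : MvPolynomial (Fin n) K) : Ideal (MvPolynomial (Fin n) K) where
  carrier := {g | diffOp K g f = 0}
  add_mem' {a b} ha hb := by
    have ha' : diffOp K a f = 0 := ha
    have hb' : diffOp K b f = 0 := hb
    simp [ha', hb']
  zero_mem' := by simp
  smul_mem' c g hg := by
    have hg' : diffOp K g f = 0 := hg
    simp [hg']

/-- The degree `d` part of `K[x₁,…,xₙ]/I`: the residue classes of the forms of degree `d`. -/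
def quotientGrading (I : Ideal (MvPolynomial (Fin n) K)) (d : ℕ) :
    Submodule K (MvPolynomial (Fin n) K ⧸ I) :=
  (homogeneousSubmodule (Fin n) K d).map (Ideal.Quotient.mkₐ K I).toLinearMap

/-- The rank of a quadric `q`: the rank of its Hessian matrix `(∂²q/∂xᵢ∂xⱼ)`, which for a quadratic
form is twice its Gram matrix (and the characteristic is different from `2` here). -/
def quadricRank (q : MvPolynomial (Fin n) K) : ℕ :=
  (Matrix.of fun i j : Fin n => constantCoeff (pderiv i (pderiv j q))).rank

/-- A graded algebra `R` with degree one part `R₁` of dimension `N` has a Gröbner flag: a complete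
flag `0 = V₀ ⊂ V₁ ⊂ ⋯ ⊂ V_N = R₁` such that every colon ideal `(Vᵢ) : (Vᵢ₊₁)` is one of the
ideals `(Vⱼ)`. -/
def HasGroebnerFlag {R : Type*} [CommRing R] [Algebra K R] (R₁ : Submodule K R) : Prop :=
  ∃ V : ℕ → Submodule K R,
    (∀ i ≤ Module.finrank K R₁, V i ≤ R₁ ∧ Module.finrank K (V i) = i) ∧
    V (Module.finrank K R₁) = R₁ ∧
    ∀ i < Module.finrank K R₁, V i ≤ V (i + 1) ∧
      ∃ j ≤ Module.finrank K R₁,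
        (Ideal.span (V i : Set R)).colon (Ideal.span (V (i + 1) : Set R) : Set R) =
          Ideal.span (V j : Set R)

/-- `G` is a Gröbner basis of the ideal `I` for the term order `m`. -/
def IsGroebnerBasis (m : MonomialOrder (Fin n)) (G : Set (MvPolynomial (Fin n) K))
    (I : Ideal (MvPolynomial (Fin n) K)) : Prop :=
  G ⊆ I ∧ Ideal.span (m.leadingTerm '' G) =
    Ideal.span (m.leadingTerm '' (I : Set (MvPolynomial (Fin n) K)))

/-- The algebra `K[x₁,…,xₙ]/I` is G-quadratic: after a linear change of coordinates `φ`, the ideal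
`I` has a Gröbner basis of quadrics for some term order. -/
def IsGQuadratic (I : Ideal (MvPolynomial (Fin n) K)) : Prop :=
  ∃ (φ : MvPolynomial (Fin n) K ≃ₐ[K] MvPolynomial (Fin n) K) (m : MonomialOrder.{0, 0} (Fin n))
    (G : Set (MvPolynomial (Fin n) K)),
    (∀ i, (φ (X i)).IsHomogeneous 1) ∧ (∀ g ∈ G, g.IsHomogeneous 2) ∧
      IsGroebnerBasis m G (I.map φ)

/-- `f` is a nonzero cubic form whose hypersurface in projective space has a singular point. -/
def IsSingularCubic (f : MvPolynomial (Fin n) K) : Prop :=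
  f.IsHomogeneous 3 ∧ f ≠ 0 ∧
    ∃ v : Fin n → K, v ≠ 0 ∧ eval v f = 0 ∧ ∀ i, eval v (pderiv i f) = 0

/-- The exponents of the monomials of degree `3` in `n` variables. -/
abbrev CubicExponent (n : ℕ) : Type := {d : Fin n →₀ ℕ // d.degree = 3}

/-- The vector of coefficients of a cubic form: its coordinates in the affine space of cubics. -/
def cubicCoeffs (f : MvPolynomial (Fin n) K) : CubicExponent n → K := fun d => coeff d.1 f

/-- `P` holds for the generic singular cubic in `n` variables: it holds for all members of a subset
of the set of singular cubics which is relatively Zariski open (the complement of the zero locus of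
`Z` in the space of coefficients) and Zariski dense (each Zariski closed set containing it contains
all singular cubics). -/
def ForGenericSingularCubic (P : MvPolynomial (Fin n) K → Prop) : Prop :=
  ∃ Z : Ideal (MvPolynomial (CubicExponent n) K),
    (∀ f, IsSingularCubic f → cubicCoeffs f ∉ zeroLocus K Z → P f) ∧
    ∀ W : Ideal (MvPolynomial (CubicExponent n) K),
      (∀ f, IsSingularCubic f → cubicCoeffs f ∉ zeroLocus K Z →
        cubicCoeffs f ∈ zeroLocus K W) →
      ∀ f : MvPolynomial (Fin n) K, IsSingularCubic f → cubicCoeffs f ∈ zeroLocus K W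

end CubicInverseSystem

end

/-! Write `Λ` for the functional g ↦ (g(∂)f)(0) on R = R_f. It lives in degree 3, and (g, h) ↦ Λ(gh)
is a perfect pairing on R. If ∂²f/∂y² = 0 and ∂f/∂y has rank n - 1, then y spans the radical of the
form (a, b) ↦ Λ(yab). Over an algebraically closed field there are coordinates with Y o = y in which
this form becomes 2 x_u x_l + ∑ x_i². This is `exists_isNodal`, and both claims follow from that
normal form.

Indeed 0 : Y o = (Y o) (`mul_o_eq_zero_iff`), and modulo Y o each product Y i * Y j is a scalar
multiple of Y u * Y l (`exists_mul_eq`). So R/(Y o) is the algebra of a nondegenerate quadric in n -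
1 variables for which Y u is isotropic with partner Y l. The flag that starts with o, u and ends
with l is a Gröbner flag. For a suitable weight order the relations have leading terms x_o² and x_i
x_j with i, j ≠ o, {i, j} ≠ {u, l}. The remaining 2n + 2 monomials are independent in R, so the
quadrics form a Gröbner basis.

For (2), let v be a singular point of f and y the linear form with coefficients v. Euler's identity
gives ∂²f/∂y² = 0 and identifies the Hessian of ∂f/∂y with the Hessian of f at v. So R_f is
G-quadratic as soon as the Hessian at some singular point has nonzero adjugate, in particular when f
has no bad point. The good cubics are open by elimination theory (`exists_separating_polynomial`).
They are dense because every point v is singular on some explicit good cubic (`exists_nodal_cubic`),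
and the line joining it to f consists of cubics singular at v. -/

noncomputable section

open MvPolynomial

namespace CubicInverseSystem

/-! ### Structure of an algebra in nodal normal form. -/

section

/-- The Gram matrix of the quadric `2 x_u x_l + ∑ x_i²`, `i ∉ {o, u, l}`, in the variables `x_i`
with `i ≠ o`. -/
def nodalGram (K : Type*) [Field K] {n : ℕ} (o u l i j : Fin n) : K :=
  if i ≠ o ∧ Equiv.swap u l i = j then 1 else 0

/-- `R` is generated by `Y`, and `Λ` is a dual socle generator of degree `3` for which `Y o` has
square zero and the quadric `(a, b) ↦ Λ (Y o * a * b)` is in normal form. -/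
structure IsNodal {K R : Type*} [Field K] [CommRing R] [Algebra K R] {n : ℕ} (Y : Fin n → R)
    (Λ : R →ₗ[K] K) (o u l : Fin n) : Prop where
  ou : o ≠ u
  ol : o ≠ l
  ul : u ≠ l
  surj : Function.Surjective (aeval Y : MvPolynomial (Fin n) K →ₐ[K] R)
  nondeg : ∀ g, (∀ h, Λ (h * g) = 0) → g = 0
  deg : ∀ (p : MvPolynomial (Fin n) K) (d : ℕ), p.IsHomogeneous d → d ≠ 3 → Λ (aeval Y p) = 0
  form : ∀ i j, Λ (Y o * Y i * Y j) = nodalGram K o u l i j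

namespace IsNodal

variable {K R : Type*} [Field K] [CommRing R] [Algebra K R] {n : ℕ} {Y : Fin n → R}
  {Λ : R →ₗ[K] K} {o u l : Fin n}

/-- `Λ` lives in degree 3, so nondegeneracy need only be tested against the complementary degree. -/
theorem aeval_eq_zero (H : IsNodal Y Λ o u l) {p : MvPolynomial (Fin n) K} {d : ℕ}
    (hp : p.IsHomogeneous d)
    (h : ∀ (q : MvPolynomial (Fin n) K) (e : ℕ), q.IsHomogeneous e → e + d = 3 →
      Λ (aeval Y q * aeval Y p) = 0) : aeval Y p = 0 := by
  refine H.nondeg _ fun r => ?_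
  obtain ⟨q, rfl⟩ := H.surj r
  induction q using MvPolynomial.induction_on' with
  | monomial s c =>
    have hs := isHomogeneous_monomial (d := s) c rfl
    by_cases he : s.degree + d = 3
    · exact h _ _ hs he
    · rw [← map_mul]
      exact H.deg _ _ (hs.mul hp) he
  | add a b ha hb => rw [map_add, add_mul, map_add, ha, hb, add_zero]

theorem aeval_eq_zero_of_four_le (H : IsNodal Y Λ o u l) {p : MvPolynomial (Fin n) K} {d : ℕ}
    (hp : p.IsHomogeneous d) (hd : 4 ≤ d) : aeval Y p = 0 :=
  H.aeval_eq_zero hp fun _ _ _ h => by omega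

theorem aeval_eq_zero_of_three (H : IsNodal Y Λ o u l) {p : MvPolynomial (Fin n) K}
    (hp : p.IsHomogeneous 3) (h : Λ (aeval Y p) = 0) : aeval Y p = 0 := by
  refine H.aeval_eq_zero hp fun q e hq he => ?_
  obtain rfl : e = 0 := by omega
  rw [← totalDegree_zero_iff_isHomogeneous, totalDegree_eq_zero_iff_eq_C] at hq
  rw [hq, aeval_C, ← Algebra.smul_def, map_smul, h, smul_zero]

theorem aeval_eq_zero_of_two (H : IsNodal Y Λ o u l) {p : MvPolynomial (Fin n) K}
    (hp : p.IsHomogeneous 2) (h : ∀ i, Λ (Y i * aeval Y p) = 0) : aeval Y p = 0 := by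
  refine H.aeval_eq_zero hp fun q e hq he => ?_
  obtain rfl : e = 1 := by omega
  rw [← mem_homogeneousSubmodule, homogeneousSubmodule_one_eq_span_X] at hq
  induction hq using Submodule.span_induction with
  | mem x hx => obtain ⟨i, rfl⟩ := hx; simpa using h i
  | zero => simp
  | add a b _ _ ha hb => rw [map_add, add_mul, map_add, ha, hb, add_zero]
  | smul c a _ ha => rw [map_smul, smul_mul_assoc, map_smul, ha, smul_zero]

theorem mul_o_o (H : IsNodal Y Λ o u l) : Y o * Y o = 0 := by
  have h := H.aeval_eq_zero_of_two (p := X o * X o) ((isHomogeneous_X _ _).mul (isHomogeneous_X _ _))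
    fun i => by
      rw [map_mul (aeval Y), aeval_X, mul_comm, H.form]
      simp [nodalGram]
  simpa using h

theorem map_omega (H : IsNodal Y Λ o u l) : Λ (Y o * Y u * Y l) = 1 := by
  rw [H.form]
  simp [nodalGram, H.ou.symm]

/-- The socle is a line, and Y o * Y u * Y l spans it because `Λ` takes the value 1 there. -/
theorem triple (H : IsNodal Y Λ o u l) (i j k : Fin n) :
    Y i * Y j * Y k = algebraMap K R (Λ (Y i * Y j * Y k)) * (Y o * Y u * Y l) := by
  have hX := isHomogeneous_X (R := K) (σ := Fin n)
  have h := H.aeval_eq_zero_of_three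
    (p := X i * X j * X k - C (Λ (Y i * Y j * Y k)) * (X o * X u * X l))
    ((((hX i).mul (hX j)).mul (hX k)).sub ((((hX o).mul (hX u)).mul (hX l)).C_mul _)) (by
      simp only [map_sub, map_mul, aeval_X, aeval_C]
      rw [← Algebra.smul_def, map_smul, H.map_omega]
      simp)
  simpa [sub_eq_zero] using h

theorem o_mul_mul (H : IsNodal Y Λ o u l) (i j : Fin n) :
    Y o * Y i * Y j = algebraMap K R (nodalGram K o u l i j) * (Y o * Y u * Y l) := by
  rw [← H.form, ← H.triple]

theorem omega_mul (H : IsNodal Y Λ o u l) (i : Fin n) : Y o * Y u * Y l * Y i = 0 := by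
  have hX := isHomogeneous_X (R := K) (σ := Fin n)
  simpa using H.aeval_eq_zero_of_four_le ((((hX o).mul (hX u)).mul (hX l)).mul (hX i)) le_rfl

theorem eq_zero_of_mul_omega (H : IsNodal Y Λ o u l) {a : K}
    (h : algebraMap K R a * (Y o * Y u * Y l) = 0) : a = 0 := by
  have := congrArg Λ h
  rwa [← Algebra.smul_def, map_smul, H.map_omega, smul_eq_mul, mul_one, map_zero] at this

/-- After subtraction of the multiple of Y u * Y l, the product is annihilated by Y o; by duality
such a quadric lies in Y o * R₁. -/
theorem exists_mul_eq (H : IsNodal Y Λ o u l) {i j : Fin n} (hi : i ≠ o) :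
    ∃ c : Fin n → K, Y i * Y j = algebraMap K R (nodalGram K o u l i j) * (Y u * Y l) +
      ∑ k, algebraMap K R (c k) * (Y o * Y k) := by
  have hX := isHomogeneous_X (R := K) (σ := Fin n)
  set σ := Equiv.swap u l with hσ
  -- The form (a, b) ↦ Λ(Y o * a * b) pairs Y k exactly with Y (σ k), so testing against Y (σ k)
  -- reads off the coefficient of Y o * Y k.
  set c : Fin n → K := fun k =>
    Λ (Y (σ k) * (Y i * Y j - algebraMap K R (nodalGram K o u l i j) * (Y u * Y l))) with hc
  refine ⟨c, ?_⟩
  have h := H.aeval_eq_zero_of_two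
    (p := X i * X j - C (nodalGram K o u l i j) * (X u * X l) - ∑ k, C (c k) * (X o * X k))
    ((((hX i).mul (hX j)).sub (((hX u).mul (hX l)).C_mul _)).sub
      (IsHomogeneous.sum _ _ _ fun k _ => ((hX o).mul (hX k)).C_mul _)) (by
    intro m
    have h1 : ∀ k, Λ (Y m * (algebraMap K R (c k) * (Y o * Y k))) =
        if σ m = k ∧ m ≠ o then c k else 0 := by
      intro k
      rw [show Y m * (algebraMap K R (c k) * (Y o * Y k)) = algebraMap K R (c k) * (Y o * Y m * Y k)
        by ring, ← Algebra.smul_def, map_smul, H.form, nodalGram]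
      by_cases h : σ m = k ∧ m ≠ o
      · rw [if_pos ⟨h.2, h.1⟩, if_pos h]; simp
      · rw [if_neg (fun h' => h ⟨h'.2, h'.1⟩), if_neg h]; simp
    simp only [map_sub, map_mul, aeval_X, aeval_C, map_sum]
    rw [mul_sub, map_sub, Finset.mul_sum, map_sum]
    simp only [h1]
    by_cases hm : m = o
    · subst hm
      have h2 : Y m * (Y i * Y j - algebraMap K R (nodalGram K m u l i j) * (Y u * Y l)) =
          Y m * Y i * Y j - algebraMap K R (nodalGram K m u l i j) * (Y m * Y u * Y l) := by ring
      rw [h2, ← H.o_mul_mul]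
      simp
    · simp [hm, hc, hσ])
  simp only [map_sub, map_mul, aeval_X, aeval_C, map_sum] at h
  linear_combination h

/-- Modulo Y o, degree 2 is spanned by Y u * Y l and degree 3 vanishes, since the socle generator is
a multiple of Y o. -/
theorem exists_normal_form (H : IsNodal Y Λ o u l) (r : R) :
    ∃ (a : K) (b : Fin n → K) (e : K) (s : R), r = algebraMap K R a +
      ∑ k, algebraMap K R (b k) * Y k + algebraMap K R e * (Y u * Y l) + s * Y o := by
  obtain ⟨q, rfl⟩ := H.surj r
  induction q using MvPolynomial.induction_on with
  | C a => exact ⟨a, 0, 0, 0, by simp⟩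
  | add p q hp hq =>
    obtain ⟨a, b, e, s, h⟩ := hp
    obtain ⟨a', b', e', s', h'⟩ := hq
    refine ⟨a + a', b + b', e + e', s + s', ?_⟩
    rw [map_add, h, h']
    simp only [map_add, Pi.add_apply, add_mul, Finset.sum_add_distrib]
    ring
  | mul_X p i hp =>
    obtain ⟨a, b, e, s, h⟩ := hp
    by_cases hi : i = o
    · subst hi
      exact ⟨0, 0, 0, aeval Y p, by simp⟩
    choose c hc using fun j => H.exists_mul_eq (j := j) hi
    refine ⟨0, Pi.single i a, ∑ k, b k * nodalGram K o u l i k,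
      ∑ k, algebraMap K R (b k) * ∑ m, algebraMap K R (c k m) * Y m +
        algebraMap K R (e * Λ (Y u * Y l * Y i)) * (Y u * Y l) + s * Y i, ?_⟩
    have h3 := H.triple u l i
    have h1 : ∑ k, algebraMap K R (Pi.single (M := fun _ => K) i a k) * Y k =
        algebraMap K R a * Y i := by
      rw [Finset.sum_eq_single i]
      · simp
      · intro b _ hb; simp [hb]
      · simp
    have h2 : (∑ k, algebraMap K R (b k) * Y k) * Y i =
        (∑ k, algebraMap K R (b k * nodalGram K o u l i k)) * (Y u * Y l) +
          (∑ k, algebraMap K R (b k) * ∑ m, algebraMap K R (c k m) * Y m) * Y o := by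
      rw [Finset.sum_mul, Finset.sum_mul, Finset.sum_mul, ← Finset.sum_add_distrib]
      refine Finset.sum_congr rfl fun k _ => ?_
      rw [mul_assoc, mul_comm (Y k), hc k, mul_assoc (algebraMap K R (b k)), Finset.sum_mul, map_mul,
        mul_add]
      congr 1
      · ring
      · congr 1
        exact Finset.sum_congr rfl fun m _ => by ring
    rw [map_mul, aeval_X, h, h1, map_zero, map_sum, map_mul]
    linear_combination h2 + algebraMap K R e * h3

theorem sum_mul_o_mul (H : IsNodal Y Λ o u l) (b : Fin n → K) {m : Fin n} (hm : m ≠ o) :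
    (∑ k, algebraMap K R (b k) * Y k) * (Y o * Y (Equiv.swap u l m)) =
      algebraMap K R (b m) * (Y o * Y u * Y l) := by
  rw [Finset.sum_mul, Finset.sum_eq_single m]
  · rw [show algebraMap K R (b m) * Y m * (Y o * Y (Equiv.swap u l m)) =
      algebraMap K R (b m) * (Y o * Y m * Y (Equiv.swap u l m)) by ring, H.o_mul_mul]
    simp [nodalGram, hm]
  · intro k _ hk
    rw [show algebraMap K R (b k) * Y k * (Y o * Y (Equiv.swap u l m)) =
      algebraMap K R (b k) * (Y o * Y k * Y (Equiv.swap u l m)) by ring, H.o_mul_mul]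
    simp [nodalGram, hk]
  · simp

theorem linearIndependent (H : IsNodal Y Λ o u l) : LinearIndependent K Y := by
  rw [Fintype.linearIndependent_iff]
  intro b hb
  simp only [Algebra.smul_def] at hb
  have h1 : ∀ m, m ≠ o → b m = 0 := fun m hm => by
    apply H.eq_zero_of_mul_omega
    rw [← H.sum_mul_o_mul b hm, hb, zero_mul]
  intro m
  by_cases hm : m = o
  · subst hm
    rw [Finset.sum_eq_single m (fun k _ hk => by simp [h1 k hk]) (by simp)] at hb
    apply H.eq_zero_of_mul_omega
    linear_combination (Y u * Y l) * hb
  · exact h1 m hm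

theorem mul_omega_eq_zero (H : IsNodal Y Λ o u l) {a : K} {b : Fin n → K} {e : K} {s : R}
    (h : (algebraMap K R a + ∑ k, algebraMap K R (b k) * Y k + algebraMap K R e * (Y u * Y l) +
      s * Y o) * (Y o * Y u * Y l) = 0) : a = 0 := by
  apply H.eq_zero_of_mul_omega
  have h1 : (∑ k, algebraMap K R (b k) * Y k) * (Y o * Y u * Y l) = 0 := by
    rw [Finset.sum_mul]
    refine Finset.sum_eq_zero fun k _ => ?_
    rw [mul_assoc, mul_comm (Y k), H.omega_mul, mul_zero]
  linear_combination h - h1 - (algebraMap K R e * Y l) * H.omega_mul u - s * H.omega_mul o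

/-- Multiplying the relation by Y u * Y l, by Y (swap u l m) and by 1 isolates a, b m and e in turn
as coefficients of the socle generator. -/
theorem mul_o_eq_zero (H : IsNodal Y Λ o u l) {a : K} {b : Fin n → K} {e : K} {s : R}
    (h : (algebraMap K R a + ∑ k, algebraMap K R (b k) * Y k + algebraMap K R e * (Y u * Y l) +
      s * Y o) * Y o = 0) : a = 0 ∧ (∀ m ≠ o, b m = 0) ∧ e = 0 := by
  have hoo := H.mul_o_o
  have ha : a = 0 := H.mul_omega_eq_zero (a := a) (b := b) (e := e) (s := s) (by
    linear_combination (Y u * Y l) * h)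
  rw [ha, map_zero] at h
  have hb : ∀ m, m ≠ o → b m = 0 := by
    intro m hm
    apply H.eq_zero_of_mul_omega
    rw [← H.sum_mul_o_mul b hm]
    linear_combination (Y (Equiv.swap u l m)) * h -
      algebraMap K R e * H.omega_mul (Equiv.swap u l m) - s * Y (Equiv.swap u l m) * hoo
  refine ⟨ha, hb, H.eq_zero_of_mul_omega ?_⟩
  rw [Finset.sum_eq_single o (fun k _ hk => by simp [hb k hk]) (by simp)] at h
  linear_combination h - (algebraMap K R (b o) + s) * hoo

/-- The colon ideal `0 : Y o` is generated by `Y o`. -/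
theorem mul_o_eq_zero_iff (H : IsNodal Y Λ o u l) (r : R) : r * Y o = 0 ↔ r ∈ Ideal.span {Y o} := by
  rw [Ideal.mem_span_singleton']
  constructor
  · intro h
    obtain ⟨a, b, e, s, rfl⟩ := H.exists_normal_form r
    obtain ⟨ha, hb, he⟩ := H.mul_o_eq_zero h
    refine ⟨algebraMap K R (b o) + s, ?_⟩
    rw [Finset.sum_eq_single o (fun k _ hk => by simp [hb k hk]) (by simp), ha, he, map_zero]
    ring
  · rintro ⟨s, rfl⟩
    rw [mul_assoc, H.mul_o_o, mul_zero]

end IsNodal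

end

/-! ### The remaining colon ideals and the Gröbner flag. -/

section

namespace IsNodal

variable {K R : Type*} [Field K] [CommRing R] [Algebra K R] {n : ℕ} {Y : Fin n → R}
  {Λ : R →ₗ[K] K} {o u l : Fin n}

/-- The colon ideal `(Y o) : Y u` is generated by the `Y j` with `j ≠ l`. -/
theorem mul_u_mem_iff (H : IsNodal Y Λ o u l) (r : R) :
    r * Y u ∈ Ideal.span {Y o} ↔ r ∈ Ideal.span (Y '' {j | j ≠ l}) := by
  -- Since (Y o) = 0 : Y o, membership becomes an equation that can be pushed into the socle.
  rw [← H.mul_o_eq_zero_iff]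
  constructor
  · intro h
    obtain ⟨a, b, e, s, rfl⟩ := H.exists_normal_form r
    have ha : a = 0 := H.mul_omega_eq_zero (a := a) (b := b) (e := e) (s := s)
      (by linear_combination (Y l) * h)
    have hb : b l = 0 := by
      apply H.eq_zero_of_mul_omega
      rw [← H.sum_mul_o_mul b H.ol.symm, Equiv.swap_apply_right]
      rw [ha, map_zero] at h
      linear_combination h - algebraMap K R e * H.omega_mul u - s * Y u * H.mul_o_o
    have hY : ∀ j, j ≠ l → Y j ∈ Ideal.span (Y '' {j | j ≠ l}) := fun j hj =>
      Ideal.subset_span ⟨j, hj, rfl⟩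
    rw [ha, map_zero, zero_add]
    refine add_mem (add_mem (sum_mem fun k _ => ?_) ?_) (Ideal.mul_mem_left _ _ (hY o H.ol))
    · by_cases hk : k = l
      · simp [hk, hb]
      · exact Ideal.mul_mem_left _ _ (hY k hk)
    · exact Ideal.mul_mem_left _ _ (Ideal.mul_mem_right _ _ (hY u H.ul))
  · intro h
    induction h using Submodule.span_induction with
    | mem x hx =>
      obtain ⟨j, hj, rfl⟩ := hx
      have h1 := H.o_mul_mul j u
      rw [nodalGram, if_neg, map_zero, zero_mul] at h1
      · linear_combination h1
      · rintro ⟨_, h⟩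
        apply hj
        rw [← Equiv.swap_apply_self u l j, h, Equiv.swap_apply_left]
    | zero => simp
    | add x y _ _ hx hy => linear_combination hx + hy
    | smul c x _ hx => rw [smul_eq_mul]; linear_combination c * hx

/-- Modulo an ideal generated by `Y o`, `Y u` and further `Y j`, the annihilator of any other
`Y i` is generated by all the `Y j`. -/
theorem mul_mem_span_iff (H : IsNodal Y Λ o u l) {s : Set (Fin n)} (ho : o ∈ s) (hu : u ∈ s)
    {i : Fin n} (hi : i ∉ s) (r : R) :
    r * Y i ∈ Ideal.span (Y '' s) ↔ r ∈ Ideal.span (Set.range Y) := by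
  have hio : i ≠ o := fun h => hi (h ▸ ho)
  have hY : ∀ j, Y j ∈ Ideal.span (Set.range Y) := fun j => Ideal.subset_span ⟨j, rfl⟩
  have hs : ∀ j ∈ s, Y j ∈ Ideal.span (Y '' s) := fun j hj => Ideal.subset_span ⟨j, hj, rfl⟩
  constructor
  · intro h
    -- Y o * Y (swap u l i) is dual to Y i alone and i ∉ s, so it kills the ideal; on r * Y i it
    -- therefore detects the constant term of r.
    have h0 : ∀ x ∈ Ideal.span (Y '' s), x * (Y o * Y (Equiv.swap u l i)) = 0 := by
      intro x hx
      induction hx using Submodule.span_induction with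
      | mem x hx =>
        obtain ⟨j, hj, rfl⟩ := hx
        have h1 := H.o_mul_mul j (Equiv.swap u l i)
        rw [nodalGram, if_neg, map_zero, zero_mul] at h1
        · linear_combination h1
        · rintro ⟨_, h⟩
          exact hi ((Equiv.swap u l).injective h ▸ hj)
      | zero => simp
      | add x y _ _ hx hy => linear_combination hx + hy
      | smul c x _ hx => rw [smul_eq_mul]; linear_combination c * hx
    have h1 := h0 _ h
    have h2 := H.o_mul_mul i (Equiv.swap u l i)
    rw [nodalGram, if_pos ⟨hio, rfl⟩, map_one, one_mul] at h2
    obtain ⟨a, b, e, t, rfl⟩ := H.exists_normal_form r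
    have ha : a = 0 := H.mul_omega_eq_zero (a := a) (b := b) (e := e) (s := t)
      (by rw [← h2]; linear_combination h1)
    rw [ha, map_zero, zero_add]
    exact add_mem (add_mem (sum_mem fun k _ => Ideal.mul_mem_left _ _ (hY k))
      (Ideal.mul_mem_left _ _ (Ideal.mul_mem_right _ _ (hY u)))) (Ideal.mul_mem_left _ _ (hY o))
  · intro h
    induction h using Submodule.span_induction with
    | mem x hx =>
      obtain ⟨j, rfl⟩ := hx
      obtain ⟨c, hc⟩ := H.exists_mul_eq (j := j) hio
      rw [mul_comm, hc]
      exact add_mem (Ideal.mul_mem_left _ _ (Ideal.mul_mem_right _ _ (hs u hu)))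
        (sum_mem fun k _ => Ideal.mul_mem_left _ _ (Ideal.mul_mem_right _ _ (hs o ho)))
    | zero => simp
    | add x y _ _ hx hy => rw [add_mul]; exact add_mem hx hy
    | smul c x _ hx => rw [smul_eq_mul, mul_assoc]; exact Ideal.mul_mem_left _ _ hx

/-- With o first, u second and l last, the successive colon ideals are (V 1), (V (n - 1)), and then
always (V n). -/
theorem hasGroebnerFlag (H : IsNodal Y Λ o u l) (ho : o.val = 0) (hu : u.val = 1)
    (hl : l.val + 1 = n) : HasGroebnerFlag (Submodule.span K (Set.range Y)) := by
  have hfin : Module.finrank K (Submodule.span K (Set.range Y)) = n := by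
    rw [finrank_span_eq_card H.linearIndependent, Fintype.card_fin]
  have hspan : ∀ i : ℕ, Ideal.span (Submodule.span K (Y '' {j | j.val < i}) : Set R) =
      Ideal.span (Y '' {j | j.val < i}) := fun i => Submodule.span_span_of_tower K R _
  have hul := H.ul
  have hul' : u.val ≠ l.val := fun h => hul (Fin.ext h)
  have hul'' : o.val ≠ l.val := fun h => H.ol (Fin.ext h)
  have hn : n = l.val + 1 := hl.symm
  refine ⟨fun i => Submodule.span K (Y '' {j | j.val < i}), ?_, ?_, ?_⟩
  · rw [hfin]
    intro i hi
    refine ⟨Submodule.span_mono (Set.image_subset_range _ _), ?_⟩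
    have : Y '' {j | j.val < i} = Set.range (Y ∘ Fin.castLE hi) := by
      ext x
      constructor
      · rintro ⟨j, hj, rfl⟩
        exact ⟨⟨j.val, hj⟩, rfl⟩
      · rintro ⟨j, rfl⟩
        exact ⟨Fin.castLE hi j, j.isLt, rfl⟩
    change Module.finrank K (Submodule.span K (Y '' {j | j.val < i})) = i
    rw [this, finrank_span_eq_card (H.linearIndependent.comp _ (Fin.castLE_injective hi)),
      Fintype.card_fin]
  · have h3 : {j : Fin n | j.val < n} = Set.univ := by
      ext j
      simp
    simp only [hfin, h3, Set.image_univ]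
  · rw [hfin]
    intro i hi
    refine ⟨Submodule.span_mono (Set.image_mono fun j (hj : j.val < i) => hj.trans i.lt_succ_self),
      ?_⟩
    simp only [hspan]
    have hcolon : ∀ r, r ∈ (Ideal.span (Y '' {j | j.val < i})).colon
        (Ideal.span (Y '' {j | j.val < i + 1}) : Set R) ↔
          r * Y ⟨i, hi⟩ ∈ Ideal.span (Y '' {j | j.val < i}) := by
      intro r
      rw [Submodule.mem_colon]
      constructor
      · intro h
        exact h _ (Ideal.subset_span ⟨⟨i, hi⟩, i.lt_succ_self, rfl⟩)
      · intro h x hx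
        rw [SetLike.mem_coe] at hx
        induction hx using Submodule.span_induction with
        | mem x hx =>
          obtain ⟨j, hj, rfl⟩ := hx
          rcases Nat.lt_succ_iff_lt_or_eq.mp hj with hj | hj
          · exact Ideal.mul_mem_left _ _ (Ideal.subset_span ⟨j, hj, rfl⟩)
          · obtain rfl : j = ⟨i, hi⟩ := Fin.ext hj
            exact h
        | zero => simp
        | add x y _ _ hx hy => rw [smul_add]; exact add_mem hx hy
        | smul c x _ hx => rw [smul_comm]; exact Submodule.smul_mem _ _ hx
    have h1 : {j : Fin n | j.val < 1} = {o} := by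
      ext j
      simp [Fin.ext_iff, ho]
    rcases Nat.lt_or_ge i 2 with h2 | h2
    · interval_cases i
      · refine ⟨1, by omega, ?_⟩
        ext r
        rw [hcolon, h1, Set.image_singleton, ← H.mul_o_eq_zero_iff,
          show (⟨0, hi⟩ : Fin n) = o from Fin.ext ho.symm]
        simp
      · refine ⟨l.val, by omega, ?_⟩
        ext r
        have h3 : {j : Fin n | j.val < l.val} = {j | j ≠ l} := by
          ext j
          have := j.isLt
          simp only [Set.mem_ofPred_eq, ne_eq, Fin.ext_iff]
          omega
        rw [hcolon, h1, h3, Set.image_singleton, ← H.mul_u_mem_iff,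
          show (⟨1, hi⟩ : Fin n) = u from Fin.ext hu.symm]
    · refine ⟨n, le_rfl, ?_⟩
      ext r
      have h3 : {j : Fin n | j.val < n} = Set.univ := by
        ext j
        simp
      rw [hcolon, h3, Set.image_univ]
      exact H.mul_mem_span_iff (by simp only [Set.mem_ofPred_eq]; omega)
        (by simp only [Set.mem_ofPred_eq]; omega) (by simp) r

end IsNodal

end

/-! ### Weight orders and a criterion for Gröbner bases. -/

section

/-- The homomorphism underlying the order which compares weights first. -/
def weightLexHom {σ : Type*} (m : MonomialOrder σ) (w : σ → ℕ) : (σ →₀ ℕ) →+ (ℕ ×ₗ m.syn) where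
  toFun d := toLex (Finsupp.weight w d, m.toSyn d)
  map_zero' := by simp
  map_add' a b := by simp; rfl

theorem weightLexHom_injective {σ : Type*} (m : MonomialOrder σ) (w : σ → ℕ) :
    Function.Injective (weightLexHom m w) := fun _ _ h =>
  m.toSyn.injective (congrArg (fun x => (ofLex x).2) h)

/-- Exponents as elements of the range of `weightLexHom`. -/
def weightLexEquiv {σ : Type*} (m : MonomialOrder σ) (w : σ → ℕ) :
    (σ →₀ ℕ) ≃+ AddMonoidHom.mrange (weightLexHom m w) :=
  AddEquiv.ofBijective (AddMonoidHom.mrangeRestrict (weightLexHom m w))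
    ⟨fun _ _ h => weightLexHom_injective m w (congrArg Subtype.val h),
      AddMonoidHom.mrangeRestrict_surjective (weightLexHom m w)⟩

theorem weightLexEquiv_mono {σ : Type*} (m : MonomialOrder σ) (w : σ → ℕ) :
    Monotone (weightLexEquiv m w) := fun a b h => by
  refine Subtype.mk_le_mk.mpr (Prod.Lex.toLex_mono ⟨?_, m.toSyn_monotone h⟩)
  obtain ⟨c, rfl⟩ := exists_add_of_le h
  simp

/-- The refinement by `m` of the partial order given by the weights `w`. -/
def weightOrder {σ : Type*} (m : MonomialOrder σ) (w : σ → ℕ) : MonomialOrder σ where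
  syn := AddMonoidHom.mrange (weightLexHom m w)
  toSyn := weightLexEquiv m w
  toSyn_monotone := weightLexEquiv_mono m w

theorem weightOrder_lt {σ : Type*} (m : MonomialOrder σ) (w : σ → ℕ) {a b : σ →₀ ℕ}
    (h : Finsupp.weight w a < Finsupp.weight w b) :
    (weightOrder m w).toSyn a < (weightOrder m w).toSyn b := by
  change weightLexEquiv m w a < weightLexEquiv m w b
  exact Subtype.mk_lt_mk.mpr (Prod.Lex.toLex_lt_toLex.mpr (Or.inl h))

variable {K : Type*} [Field K] {n : ℕ}

/-- A set of elements of an ideal is a Gröbner basis if the ideal has no nonzero element all of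
whose monomials are standard. -/
theorem isGroebnerBasis_of_forall_standard (m : MonomialOrder (Fin n))
    {G : Set (MvPolynomial (Fin n) K)} {I : Ideal (MvPolynomial (Fin n) K)} (hG : G ⊆ I)
    (hlc : ∀ g ∈ G, IsUnit (m.leadingCoeff g))
    (hI : ∀ r ∈ I, (∀ c ∈ r.support, ∀ b ∈ G, ¬ m.degree b ≤ c) → r = 0) :
    IsGroebnerBasis m G I := by
  refine ⟨hG, le_antisymm (Ideal.span_mono (Set.image_mono hG)) (Ideal.span_le.mpr ?_)⟩
  rintro _ ⟨f, hf, rfl⟩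
  obtain ⟨g, r, h1, h2, h3⟩ := m.div_set hlc f
  -- The remainder of the division lies in I and has only standard monomials.
  have hr : r = 0 := by
    refine hI r ?_ h3
    rw [show r = f - Finsupp.linearCombination _ (fun b : G => (b : MvPolynomial (Fin n) K)) g by
      rw [h1]; ring]
    refine sub_mem hf ?_
    rw [Finsupp.linearCombination_apply]
    exact sum_mem fun b _ => Ideal.mul_mem_left _ _ (hG b.2)
  by_cases h : ∃ b ∈ G, m.degree b ≤ m.degree f
  · obtain ⟨b, hb, hbf⟩ := h
    have hu := (hlc b hb).ne_zero
    have : m.leadingTerm f = monomial (m.degree f - m.degree b)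
        (m.leadingCoeff f * (m.leadingCoeff b)⁻¹) * m.leadingTerm b := by
      rw [MonomialOrder.leadingTerm, MonomialOrder.leadingTerm, monomial_mul,
        tsub_add_cancel_of_le hbf, inv_mul_cancel_right₀ hu]
    rw [SetLike.mem_coe, this]
    exact Ideal.mul_mem_left _ _ (Ideal.subset_span ⟨b, hb, rfl⟩)
  -- No product of the division can reach the degree of f, so the leading coefficient vanishes and f
  -- = 0.
  · have hc : coeff (m.degree f) f = 0 := by
      rw [hr, add_zero, Finsupp.linearCombination_apply, Finsupp.sum] at h1
      rw [congrArg (coeff (m.degree f)) h1, coeff_sum]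
      refine Finset.sum_eq_zero fun b _ => ?_
      rw [smul_eq_mul, mul_comm]
      rcases eq_or_ne (g b) 0 with h0 | h0
      · simp [h0]
      refine m.coeff_eq_zero_of_lt (lt_of_le_of_ne (h2 b) fun he => h ⟨b, b.2, ?_⟩)
      have hb : (b : MvPolynomial (Fin n) K) ≠ 0 := fun hb => by
        have := (hlc b b.2).ne_zero
        simp [hb] at this
      rw [← m.toSyn.injective he, m.degree_mul hb h0]
      exact le_self_add
    rw [m.coeff_degree_eq_zero_iff] at hc
    simp [hc]

end

/-! ### Standard monomials and the quadratic Gröbner basis. -/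

section

/-- The exponents outside the ideal generated by `x_o²` and the `x_i x_j` with `i, j ≠ o` and
`{i, j} ≠ {u, l}`. -/
theorem standard_cases {n : ℕ} {o u l : Fin n} (hul : u ≠ l) {c : Fin n →₀ ℕ}
    (hoo : ¬ (Finsupp.single o 1 + Finsupp.single o 1 ≤ c))
    (hc : ∀ i j, i ≠ o → j ≠ o → ¬ (i = u ∧ j = l) → ¬ (i = l ∧ j = u) →
      ¬ (Finsupp.single i 1 + Finsupp.single j 1 ≤ c)) :
    ∃ e : ℕ, e ≤ 1 ∧ (c = Finsupp.single o e ∨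
      (∃ i ≠ o, c = Finsupp.single o e + Finsupp.single i 1) ∨
      c = Finsupp.single o e + Finsupp.single u 1 + Finsupp.single l 1) := by
  have hle : ∀ i j, i ≠ j → 1 ≤ c i → 1 ≤ c j → Finsupp.single i 1 + Finsupp.single j 1 ≤ c := by
    intro i j hij hi hj k
    simp only [Finsupp.add_apply, Finsupp.single_apply]
    split_ifs with h1 h2 h2
    · exact absurd (h1.trans h2.symm) hij
    · subst h1; omega
    · subst h2; omega
    · omega
  have hle2 : ∀ i, 2 ≤ c i → Finsupp.single i 1 + Finsupp.single i 1 ≤ c := by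
    intro i hi k
    simp only [Finsupp.add_apply, Finsupp.single_apply]
    split_ifs with h1
    · subst h1; omega
    · omega
  have hco : c o ≤ 1 := by
    by_contra h
    exact hoo (hle2 o (by omega))
  have hci : ∀ i, i ≠ o → c i ≤ 1 := by
    intro i hi
    by_contra h
    exact hc i i hi hi (fun h => hul (h.1.symm.trans h.2)) (fun h => hul (h.2.symm.trans h.1))
      (hle2 i (by omega))
  refine ⟨c o, hco, ?_⟩
  by_cases h0 : ∃ i, i ≠ o ∧ 1 ≤ c i
  · obtain ⟨i, hi, hci1⟩ := h0
    right
    by_cases h1 : ∃ j, j ≠ o ∧ j ≠ i ∧ 1 ≤ c j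
    · right
      obtain ⟨j, hj, hji, hcj1⟩ := h1
      have huniq : ∀ a b, a ≠ o → b ≠ o → a ≠ b → 1 ≤ c a → 1 ≤ c b →
          (a = u ∧ b = l) ∨ (a = l ∧ b = u) := by
        intro a b ha hb hab h1 h2
        by_contra h
        rw [not_or] at h
        exact hc a b ha hb h.1 h.2 (hle a b hab h1 h2)
      have hij := huniq i j hi hj hji.symm hci1 hcj1
      ext k
      simp only [Finsupp.add_apply, Finsupp.single_apply]
      have hk := huniq i k hi
      have hk1 := hci k
      grind
    · left
      refine ⟨i, hi, ?_⟩
      push Not at h1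
      ext k
      simp only [Finsupp.add_apply, Finsupp.single_apply]
      have hk := h1 k
      have hk1 := hci k
      grind
  · left
    push Not at h0
    ext k
    simp only [Finsupp.single_apply]
    have := h0 k
    grind

namespace IsNodal

variable {K R : Type*} [Field K] [CommRing R] [Algebra K R] {n : ℕ} {Y : Fin n → R}
  {Λ : R →ₗ[K] K} {o u l : Fin n}

/-- The shape is chosen so that `mul_o_eq_zero` applies twice; c o = 0 records that x_o² is not
standard. -/
theorem exists_standard_form {r : MvPolynomial (Fin n) K}
    (hr : ∀ c ∈ r.support, ∃ e : ℕ, e ≤ 1 ∧ (c = Finsupp.single o e ∨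
      (∃ i ≠ o, c = Finsupp.single o e + Finsupp.single i 1) ∨
      c = Finsupp.single o e + Finsupp.single u 1 + Finsupp.single l 1)) :
    ∃ (a : K) (b c : Fin n → K) (e k : K), c o = 0 ∧ r = C a + ∑ i, C (b i) * X i +
      C e * (X u * X l) + (∑ i, C (c i) * X i + C k * (X u * X l)) * X o := by
  have hs : ∀ (i : Fin n) (x : K), ∑ j, C (Pi.single (M := fun _ => K) i x j) * X j =
      (C x * X i : MvPolynomial (Fin n) K) := by
    intro i x
    rw [Finset.sum_eq_single i]
    · simp
    · intro b _ hb; simp [hb]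
    · simp
  rw [r.as_sum]
  refine Finset.sum_induction _ (fun r : MvPolynomial (Fin n) K =>
    ∃ (a : K) (b c : Fin n → K) (e k : K), c o = 0 ∧ r = C a + ∑ i, C (b i) * X i +
      C e * (X u * X l) + (∑ i, C (c i) * X i + C k * (X u * X l)) * X o) ?_ ?_ ?_
  · rintro _ _ ⟨a, b, c, e, k, h, rfl⟩ ⟨a', b', c', e', k', h', rfl⟩
    refine ⟨a + a', b + b', c + c', e + e', k + k', by simp [h, h'], ?_⟩
    simp only [map_add, Pi.add_apply, add_mul, Finset.sum_add_distrib]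
    ring
  · exact ⟨0, 0, 0, 0, 0, rfl, by simp⟩
  · intro d hd
    set x := coeff d r
    obtain ⟨e, he, h⟩ := hr d hd
    interval_cases e
    · rcases h with h | ⟨i, _, h⟩ | h
      · exact ⟨x, 0, 0, 0, 0, rfl, by rw [h]; simp⟩
      · exact ⟨0, Pi.single i x, 0, 0, 0, rfl, by rw [hs]; simp [h, C_mul_X_eq_monomial]⟩
      · refine ⟨0, 0, 0, x, 0, rfl, ?_⟩
        rw [h]; simp [X, monomial_mul, C_mul_monomial]
    · rcases h with h | ⟨i, hi, h⟩ | h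
      · exact ⟨0, Pi.single o x, 0, 0, 0, rfl, by rw [hs]; simp [h, C_mul_X_eq_monomial]⟩
      · refine ⟨0, 0, Pi.single i x, 0, 0, by simp [hi.symm], ?_⟩
        rw [hs, h]; simp [X, monomial_mul, C_mul_monomial, add_comm]
      · refine ⟨0, 0, 0, 0, x, rfl, ?_⟩
        rw [h]; simp [X, monomial_mul, C_mul_monomial, add_comm, add_left_comm]

/-- Multiplication by Y o kills the terms in the last summand and forces a, e and b m (m ≠ o) to
vanish. What remains is a relation q * Y o = 0 with constant term b o in q, and the same argument
applies to q. -/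
theorem eq_zero_of_standard (H : IsNodal Y Λ o u l) {r : MvPolynomial (Fin n) K}
    (hr : ∀ c ∈ r.support, ∃ e : ℕ, e ≤ 1 ∧ (c = Finsupp.single o e ∨
      (∃ i ≠ o, c = Finsupp.single o e + Finsupp.single i 1) ∨
      c = Finsupp.single o e + Finsupp.single u 1 + Finsupp.single l 1))
    (h0 : aeval Y r = 0) : r = 0 := by
  obtain ⟨a, b, c, e, k, hc, rfl⟩ := exists_standard_form hr
  simp only [map_add, map_mul, map_sum, aeval_C, aeval_X] at h0
  obtain ⟨ha, hb, he⟩ := H.mul_o_eq_zero (a := a) (b := b) (e := e)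
    (s := ∑ i, algebraMap K R (c i) * Y i + algebraMap K R k * (Y u * Y l)) (by rw [h0, zero_mul])
  have hbs : ∀ {A : Type _} [CommRing A] [Algebra K A] (Z : Fin n → A),
      ∑ i, algebraMap K A (b i) * Z i = algebraMap K A (b o) * Z o := fun Z =>
    Finset.sum_eq_single o (fun k _ hk => by simp [hb k hk]) (by simp)
  rw [hbs, ha, he, map_zero] at h0
  obtain ⟨hbo, hcm, hk⟩ := H.mul_o_eq_zero (a := b o) (b := c) (e := k) (s := 0)
    (by linear_combination h0)
  have hc0 : c = 0 := funext fun i => by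
    by_cases hi : i = o
    · rw [hi, hc]; rfl
    · exact hcm i hi
  have hb0 : b = 0 := funext fun i => by
    by_cases hi : i = o
    · rw [hi, hbo]; rfl
    · exact hb i hi
  simp [ha, he, hk, hc0, hb0]

/-- The weights `0` for `o`, `2` for `u` and `l`, `3` otherwise. -/
def nodalWeight (o u l i : Fin n) : ℕ := if i = o then 0 else if i = u ∨ i = l then 2 else 3

theorem degree_X_mul_X_sub (m : MonomialOrder (Fin n)) (w : Fin n → ℕ) (i j : Fin n)
    {h : MvPolynomial (Fin n) K}
    (hh : h ∈ restrictSupport K {c | Finsupp.weight w c < w i + w j}) :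
    (weightOrder m w).degree (X i * X j - h) = Finsupp.single i 1 + Finsupp.single j 1 := by
  have hd : (weightOrder m w).degree (X i * X j : MvPolynomial (Fin n) K) =
      Finsupp.single i 1 + Finsupp.single j 1 := by
    rw [MonomialOrder.degree_mul (X_ne_zero i) (X_ne_zero j), MonomialOrder.degree_X,
      MonomialOrder.degree_X]
  rw [MonomialOrder.degree_sub_of_lt, hd]
  rw [hd, MonomialOrder.degree_lt_iff]
  · intro c hc
    apply weightOrder_lt
    simpa [Finsupp.weight_single] using hh hc
  · rw [map_zero, MonomialOrder.toSyn_lt_iff_ne_zero, ne_eq, MonomialOrder.toSyn_eq_zero_iff]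
    intro h0
    simpa using DFunLike.congr_fun h0 i

/-- The kernel of `X i ↦ Y i` has a Gröbner basis of quadrics. -/
theorem exists_isGroebnerBasis (H : IsNodal Y Λ o u l) :
    ∃ (m : MonomialOrder.{0, 0} (Fin n)) (G : Set (MvPolynomial (Fin n) K)),
      (∀ g ∈ G, g.IsHomogeneous 2) ∧
      IsGroebnerBasis m G (RingHom.ker (aeval Y : MvPolynomial (Fin n) K →ₐ[K] R)) := by
  have hX := isHomogeneous_X (R := K) (σ := Fin n)
  -- For i, j ≠ o the weight of x_i x_j is at least 4, above the at most 3 of x_o x_k; for i ∉ {o,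
  -- u, l} the weight 6 of x_i² exceeds the 4 of x_u x_l.
  set w := nodalWeight o u l with hw
  set m : MonomialOrder.{0, 0} (Fin n) := weightOrder MonomialOrder.lex w with hm
  have hwo : w o = 0 := by simp [hw, nodalWeight]
  have hw2 : ∀ i, i ≠ o → 2 ≤ w i := fun i hi => by simp only [hw, nodalWeight]; grind
  have hw3 : ∀ i, w i ≤ 3 := fun i => by simp only [hw, nodalWeight]; grind
  refine ⟨m, {g | g.IsHomogeneous 2 ∧ aeval Y g = 0 ∧ g ≠ 0}, fun g hg => hg.1,
    isGroebnerBasis_of_forall_standard m (fun g hg => hg.2.1)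
      (fun g hg => (isUnit_iff_ne_zero.mpr (m.leadingCoeff_ne_zero_iff.mpr hg.2.2))) ?_⟩
  intro r hr hstd
  refine H.eq_zero_of_standard (fun c hc => ?_) hr
  have hmem : ∀ i j (h : MvPolynomial (Fin n) K), h.IsHomogeneous 2 → Y i * Y j = aeval Y h →
      h ∈ restrictSupport K {c | Finsupp.weight w c < w i + w j} →
      ¬ (Finsupp.single i 1 + Finsupp.single j 1 ≤ c) := by
    intro i j h hh hY hs
    have hdeg := degree_X_mul_X_sub MonomialOrder.lex w i j hs
    rw [← hdeg]
    refine hstd c hc _ ⟨((hX i).mul (hX j)).sub hh, by simp [hY], fun h0 => ?_⟩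
    rw [h0, MonomialOrder.degree_zero] at hdeg
    simpa using DFunLike.congr_fun hdeg.symm i
  refine standard_cases H.ul ?_ ?_
  · exact hmem o o 0 (isHomogeneous_zero _ _ _) (by rw [H.mul_o_o, map_zero]) (zero_mem _)
  · intro i j hi hj h1 h2
    obtain ⟨d, hd⟩ := H.exists_mul_eq (j := j) hi
    refine hmem i j (C (nodalGram K o u l i j) * (X u * X l) + ∑ k, C (d k) * (X o * X k))
      ((((hX u).mul (hX l)).C_mul _).add
        (IsHomogeneous.sum _ _ _ fun k _ => ((hX o).mul (hX k)).C_mul _)) ?_ ?_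
    · simp only [hd, map_add, map_mul, map_sum, aeval_C, aeval_X]
    · have hXX : ∀ (x : K) (a b : Fin n), w a + w b < w i + w j →
          C x * (X a * X b) ∈ restrictSupport K {c | Finsupp.weight w c < w i + w j} := by
        intro x a b hab
        rw [C_mul']
        refine Submodule.smul_mem _ _ ?_
        rw [mem_restrictSupport_iff]
        intro c hc
        rw [X, X, monomial_mul, Finset.mem_coe] at hc
        have := support_monomial_subset hc
        rw [Finset.mem_singleton] at this
        simpa [this, Finsupp.weight_single] using hab
      refine add_mem ?_ (sum_mem fun k _ => hXX _ _ _ ?_)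
      -- The term x_u x_l occurs only if swap u l i = j; as {i, j} ≠ {u, l}, this means i = j ∉ {u,
      -- l}.
      · by_cases hg : i ≠ o ∧ Equiv.swap u l i = j
        · apply hXX
          have h3 : ∀ a, a = u ∨ a = l → w a = 2 := by
            intro a ha
            simp only [hw, nodalWeight]
            have := H.ou
            have := H.ol
            grind
          have hiu : i ≠ u := by rintro rfl; exact h1 ⟨rfl, by simpa using hg.2.symm⟩
          have hil : i ≠ l := by rintro rfl; exact h2 ⟨rfl, by simpa using hg.2.symm⟩
          have hij : i = j := by simpa [Equiv.swap_apply_of_ne_of_ne hiu hil] using hg.2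
          have h4 : w i = 3 := by simp [hw, nodalWeight, hi, hiu, hil]
          rw [← hij, h3 u (Or.inl rfl), h3 l (Or.inr rfl), h4]
          norm_num
        · simp [nodalGram, hg]
      · have := hw3 k
        have := hw2 i hi
        have := hw2 j hj
        omega

end IsNodal

end

/-! ### Inverse systems, the dual socle generator and linear coordinates. -/

section

variable {K : Type*} [Field K] {n : ℕ}

theorem diffOp_X_apply (i : Fin n) (f : MvPolynomial (Fin n) K) :
    diffOp K (X i) f = pderiv i f := by
  rw [diffOp_X]; rfl

theorem diffOp_mul_apply (g h f : MvPolynomial (Fin n) K) :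
    diffOp K (g * h) f = diffOp K g (diffOp K h f) := by
  rw [map_mul]; rfl

theorem exists_eq_add_single {d : Fin n →₀ ℕ} {N : ℕ} (h : d.degree = N + 1) :
    ∃ (d' : Fin n →₀ ℕ) (i : Fin n), d = d' + Finsupp.single i 1 ∧ d'.degree = N := by
  have hd : d ≠ 0 := by
    rintro rfl
    simp at h
  obtain ⟨i, hi⟩ := Finsupp.ne_iff.mp hd
  have hle : Finsupp.single i 1 ≤ d := by
    rw [Finsupp.single_le_iff]
    exact Nat.one_le_iff_ne_zero.mpr hi
  refine ⟨d - Finsupp.single i 1, i, (tsub_add_cancel_of_le hle).symm, ?_⟩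
  have := congrArg Finsupp.degree (tsub_add_cancel_of_le hle)
  rw [map_add, Finsupp.degree_single, h] at this
  omega

/-- A polynomial is determined by the constant terms of its derivatives. -/
theorem eq_zero_of_constantCoeff_diffOp [CharZero K] {p : MvPolynomial (Fin n) K}
    (hp : ∀ h, constantCoeff (diffOp K h p) = 0) : p = 0 := by
  have key : ∀ (N : ℕ) (d : Fin n →₀ ℕ), d.degree = N → ∀ p : MvPolynomial (Fin n) K,
      (∀ h, constantCoeff (diffOp K h p) = 0) → coeff d p = 0 := by
    intro N
    induction N with
    | zero =>
      intro d hd p hp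
      rw [Finsupp.degree_eq_zero_iff] at hd
      simpa [hd, constantCoeff_eq] using hp 1
    | succ N ih =>
      intro d hd p hp
      obtain ⟨d', i, rfl, hd'⟩ := exists_eq_add_single hd
      have h := ih d' hd' (pderiv i p) fun h => by
        rw [← diffOp_X_apply, ← diffOp_mul_apply]
        exact hp _
      -- Differentiation multiplies the coefficient by a positive integer, which is nonzero in
      -- characteristic 0.
      rw [coeff_pderiv, mul_eq_zero] at h
      exact h.resolve_right (Nat.cast_add_one_ne_zero _)
  ext d
  simpa using key _ d rfl p hp

theorem degree_add_degree_of_coeff_diffOp {f : MvPolynomial (Fin n) K} {e : ℕ}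
    (hf : f.IsHomogeneous e) (N : ℕ) : ∀ s : Fin n →₀ ℕ, s.degree = N → ∀ m : Fin n →₀ ℕ,
      coeff m (diffOp K (monomial s 1) f) ≠ 0 → m.degree + N = e := by
  induction N with
  | zero =>
    intro s hs m hm
    rw [Finsupp.degree_eq_zero_iff] at hs
    rw [hs, ← C_apply, C_1, map_one] at hm
    by_contra h
    exact hm (hf.coeff_eq_zero h)
  | succ N ih =>
    intro s hs m hm
    obtain ⟨s', i, rfl, hs'⟩ := exists_eq_add_single hs
    rw [show (monomial (s' + Finsupp.single i 1) 1 : MvPolynomial (Fin n) K) =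
      X i * monomial s' 1 by rw [X, monomial_mul, add_comm, one_mul], diffOp_mul_apply,
      diffOp_X_apply, coeff_pderiv] at hm
    have := ih s' hs' _ (left_ne_zero_of_mul hm)
    rw [map_add, Finsupp.degree_single] at this
    omega

/-- The functional `g ↦ (g(∂) f)(0)`. -/
def dualSocle (f : MvPolynomial (Fin n) K) : MvPolynomial (Fin n) K →ₗ[K] K :=
  lcoeff K 0 ∘ₗ LinearMap.applyₗ f ∘ₗ (diffOp K).toLinearMap

theorem dualSocle_apply (f g : MvPolynomial (Fin n) K) :
    dualSocle f g = constantCoeff (diffOp K g f) := rfl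

theorem dualSocle_eq_zero {f g : MvPolynomial (Fin n) K} {d e : ℕ} (hf : f.IsHomogeneous e)
    (hg : g.IsHomogeneous d) (hde : d ≠ e) : dualSocle f g = 0 := by
  rw [g.as_sum, map_sum]
  refine Finset.sum_eq_zero fun s hs => ?_
  rw [← mul_one (coeff s g), ← smul_eq_mul, ← smul_monomial, map_smul]
  by_contra h
  have hd : s.degree = d := by
    by_contra h'
    exact (mem_support_iff.mp hs) (hg.coeff_eq_zero h')
  have := degree_add_degree_of_coeff_diffOp hf d s hd 0 (right_ne_zero_of_mul h)
  rw [map_zero] at this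
  omega

/-- The functional induced by `dualSocle f` on the quotient by the inverse system ideal. -/
def quotientSocle (f : MvPolynomial (Fin n) K) :
    (MvPolynomial (Fin n) K ⧸ inverseSystemIdeal f) →ₗ[K] K :=
  Submodule.liftQ ((inverseSystemIdeal f).restrictScalars K) (dualSocle f) (fun g hg => by
      have hg' : diffOp K g f = 0 := hg
      rw [LinearMap.mem_ker, dualSocle_apply, hg', map_zero]) ∘ₗ
    (Submodule.Quotient.restrictScalarsEquiv K (inverseSystemIdeal f)).symm.toLinearMap

theorem quotientSocle_mk (f g : MvPolynomial (Fin n) K) :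
    quotientSocle f (Ideal.Quotient.mk _ g) = dualSocle f g := rfl

/-- The linear form with coefficients `v`. -/
def linForm (K : Type*) [Field K] (n : ℕ) : (Fin n → K) →ₗ[K] MvPolynomial (Fin n) K :=
  Fintype.linearCombination K X

theorem linForm_apply (v : Fin n → K) : linForm K n v = ∑ i, v i • X i := rfl

theorem linForm_single (i : Fin n) : linForm K n (Pi.single i 1) = X i := by
  simp [linForm, Fintype.linearCombination_apply_single]

theorem range_linForm : LinearMap.range (linForm K n) = homogeneousSubmodule (Fin n) K 1 := by
  rw [linForm, Fintype.range_linearCombination, homogeneousSubmodule_one_eq_span_X]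

theorem isHomogeneous_linForm (v : Fin n → K) : (linForm K n v).IsHomogeneous 1 := by
  rw [← mem_homogeneousSubmodule, ← range_linForm]
  exact ⟨v, rfl⟩

/-- The linear change of coordinates which sends `X i` to the linear form of the basis vector
`b i`. -/
def linEquiv (b : Module.Basis (Fin n) K (Fin n → K)) :
    MvPolynomial (Fin n) K ≃ₐ[K] MvPolynomial (Fin n) K :=
  AlgEquiv.ofAlgHom (aeval fun i => linForm K n (b i))
    (aeval fun i => linForm K n (b.equivFun (Pi.single i 1)))
    (by
      ext1 i
      simp only [AlgHom.comp_apply, aeval_X, AlgHom.id_apply]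
      rw [linForm_apply, map_sum]
      simp only [map_smul, aeval_X]
      simp only [← map_smul, ← map_sum]
      rw [b.sum_equivFun, linForm_single])
    (by
      ext1 i
      simp only [AlgHom.comp_apply, aeval_X, AlgHom.id_apply]
      rw [linForm_apply, map_sum]
      simp only [map_smul, aeval_X]
      simp only [← map_smul, ← map_sum]
      rw [← pi_eq_sum_univ' (b i), ← linForm_single]
      congr 1
      ext j
      rw [b.equivFun_self]
      simp [Pi.single_apply, eq_comm])

theorem linEquiv_X (b : Module.Basis (Fin n) K (Fin n → K)) (i : Fin n) :
    linEquiv b (X i) = linForm K n (b i) := by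
  simp [linEquiv]

theorem linEquiv_symm_X (b : Module.Basis (Fin n) K (Fin n → K)) (i : Fin n) :
    (linEquiv b).symm (X i) = linForm K n (b.equivFun (Pi.single i 1)) := by
  simp [linEquiv]

end

/-! ### Normal form of a symmetric bilinear form of corank one. -/

section

variable {K : Type*} [Field K] {n : ℕ}

/-- An orthonormal family together with a generator of the radical of a symmetric form of
corank one. -/
theorem exists_orthonormal_of_radical [CharZero K] [IsAlgClosed K]
    {B : LinearMap.BilinForm K (Fin n → K)} (hB : ∀ a b, B a b = B b a) {v : Fin n → K} (hv : v ≠ 0)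
    (hvB : ∀ a, B v a = 0) (hker : ∀ a, (∀ b, B a b = 0) → ∃ c : K, a = c • v) (o : Fin n) :
    ∃ a : Fin n → (Fin n → K), a o = v ∧ ∀ i j, B (a i) (a j) = if i ≠ o ∧ i = j then 1 else 0 := by
  have : Invertible (2 : K) := invertibleOfNonzero two_ne_zero
  obtain ⟨e₀, he₀⟩ := LinearMap.BilinForm.exists_orthogonal_basis (B := B) ⟨hB⟩
  set e := e₀.reindex (finCongr (Module.finrank_fin_fun K)) with hee
  have he : ∀ i j, i ≠ j → B (e i) (e j) = 0 := by
    intro i j hij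
    simp only [hee, Module.Basis.reindex_apply]
    exact he₀ (fun h => hij ((finCongr (Module.finrank_fin_fun K)).symm.injective h))
  have hrad : ∀ i, B (e i) (e i) = 0 → ∃ c : K, e i = c • v := by
    intro i hi
    refine hker _ fun b => ?_
    rw [← e.sum_equivFun b, map_sum]
    refine Finset.sum_eq_zero fun j _ => ?_
    rw [map_smul]
    by_cases hij : i = j
    · rw [← hij, hi, smul_zero]
    · rw [he i j hij, smul_zero]
  -- As v is in the radical, a basis vector e k that occurs in v is isotropic. Isotropic basis
  -- vectors are multiples of v, so there is no second one.
  obtain ⟨k, hk⟩ : ∃ k, e.repr v k ≠ 0 := by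
    by_contra h
    push Not at h
    exact hv (e.repr.map_eq_zero_iff.mp (Finsupp.ext h))
  have hkk : B (e k) (e k) = 0 := by
    have h := hvB (e k)
    rw [← e.sum_equivFun v, map_sum, LinearMap.sum_apply, Finset.sum_eq_single k] at h
    · rw [map_smul, LinearMap.smul_apply, smul_eq_mul, mul_eq_zero] at h
      exact h.resolve_left hk
    · intro j _ hj
      rw [map_smul, LinearMap.smul_apply, he j k hj, smul_zero]
    · simp
  have hne : ∀ i, i ≠ k → B (e i) (e i) ≠ 0 := by
    intro i hik hi
    obtain ⟨c, hc⟩ := hrad i hi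
    obtain ⟨c', hc'⟩ := hrad k hkk
    have hc0 : c ≠ 0 := by
      rintro rfl
      rw [zero_smul] at hc
      exact e.ne_zero i hc
    have h1 : e k = (c' * c⁻¹) • e i := by
      rw [hc, smul_smul, inv_mul_cancel_right₀ hc0, hc']
    have h2 := congrArg (fun x => e.repr x k) h1
    simp [hik] at h2
  have hsq : ∀ i, ∃ s : K, s ^ 2 = B (e i) (e i) := fun i =>
    IsAlgClosed.exists_pow_nat_eq _ two_pos
  choose s hs using hsq
  set τ := Equiv.swap o k with hτ
  have hτk : ∀ i, i ≠ o → τ i ≠ k := by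
    intro i hi h
    apply hi
    rw [← Equiv.swap_apply_self o k i, ← hτ, h, Equiv.swap_apply_right]
  refine ⟨fun i => if i = o then v else (s (τ i))⁻¹ • e (τ i), if_pos rfl, fun i j => ?_⟩
  by_cases hi : i = o
  · simp [hi, hvB]
  by_cases hj : j = o
  · have : ¬ (i ≠ o ∧ i = j) := fun h => h.1 (h.2.trans hj)
    simp only [if_neg this, if_pos hj]
    rw [hB, hvB]
  · simp only [if_neg hi, if_neg hj, map_smul, LinearMap.smul_apply, smul_eq_mul]
    by_cases hij : i = j
    · rw [← hij, if_pos ⟨hi, rfl⟩, ← hs]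
      have : s (τ i) ≠ 0 := by
        intro h0
        apply hne _ (hτk i hi)
        rw [← hs, h0, zero_pow two_ne_zero]
      field_simp
    · rw [if_neg (fun h => hij h.2), he _ _ (fun h => hij (τ.injective h)), mul_zero, mul_zero]

/-- A symmetric form of corank one has the Gram matrix `nodalGram` in a suitable basis. -/
theorem exists_basis_nodalGram [CharZero K] [IsAlgClosed K]
    {B : LinearMap.BilinForm K (Fin n → K)} (hB : ∀ a b, B a b = B b a) {v : Fin n → K} (hv : v ≠ 0)
    (hvB : ∀ a, B v a = 0) (hker : ∀ a, (∀ b, B a b = 0) → ∃ c : K, a = c • v) {o u l : Fin n}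
    (hou : o ≠ u) (hol : o ≠ l) (hul : u ≠ l) :
    ∃ b : Module.Basis (Fin n) K (Fin n → K), b o = v ∧
      ∀ i j, B (b i) (b j) = nodalGram K o u l i j := by
  obtain ⟨a, hao, ha⟩ := exists_orthonormal_of_radical hB hv hvB hker o
  obtain ⟨ι, hι⟩ := IsAlgClosed.exists_pow_nat_eq (-1 : K) two_pos
  -- Since ι² = -1, the vectors a u + ι a l and (a u - ι a l)/2 are isotropic, and they pair to (1 -
  -- ι²)/2 = 1.
  set b : Fin n → (Fin n → K) := fun i =>
    if i = u then a u + ι • a l else if i = l then (2⁻¹ : K) • (a u - ι • a l) else a i with hb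
  have hbo : b o = v := by simp [hb, hou, hol, hao]
  have hgram : ∀ i j, B (b i) (b j) = nodalGram K o u l i j := by
    intro i j
    have h2 : (2 : K) ≠ 0 := two_ne_zero
    have hι2 : ι * ι = -1 := by rw [← hι]; ring
    have hlu := hul.symm
    have huo := hou.symm
    have hlo := hol.symm
    by_cases hiu : i = u
    · subst hiu
      by_cases hju : j = i
      · subst hju
        simp [nodalGram, *]
      · by_cases hjl : j = l
        · subst hjl
          simp [nodalGram, *]
          norm_num
        · simp [hb, ha, nodalGram, hju, hjl, Ne.symm hju, Ne.symm hjl]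
    · by_cases hil : i = l
      · subst hil
        by_cases hju : j = u
        · subst hju
          simp [nodalGram, *]
          norm_num
        · by_cases hjl : j = i
          · subst hjl
            simp [nodalGram, *]
          · simp [hb, ha, nodalGram, hju, hjl, hlu, Ne.symm hju, Ne.symm hjl]
      · have hsw : Equiv.swap u l i = i := Equiv.swap_apply_of_ne_of_ne hiu hil
        by_cases hju : j = u
        · subst hju
          simp [hb, ha, nodalGram, hsw, hiu, hil]
        · by_cases hjl : j = l
          · subst hjl
            simp [hb, ha, nodalGram, hsw, hiu, hil, hlu]
          · simp [hb, ha, nodalGram, hsw, hiu, hil, hju, hjl]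
  have hli : LinearIndependent K b := by
    rw [Fintype.linearIndependent_iff]
    intro x hx
    have h1 : ∀ m, m ≠ o → x m = 0 := by
      intro m hm
      have h := congrArg (fun z => B z (b (Equiv.swap u l m))) hx
      simp only [map_sum, LinearMap.sum_apply, map_smul, LinearMap.smul_apply, hgram, map_zero,
        LinearMap.zero_apply] at h
      rw [Finset.sum_eq_single m] at h
      · simpa [nodalGram, hm] using h
      · intro k _ hk
        simp [nodalGram, hk]
      · simp
    intro m
    by_cases hm : m = o
    · subst hm
      rw [Finset.sum_eq_single m (fun k _ hk => by simp [h1 k hk]) (by simp), hbo, smul_eq_zero]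
        at hx
      exact hx.resolve_right hv
    · exact h1 m hm
  have : Nonempty (Fin n) := ⟨o⟩
  refine ⟨basisOfLinearIndependentOfCardEqFinrank hli (by simp), ?_, ?_⟩
  · simpa using hbo
  · simpa using hgram

end

/-! ### From the hypothesis on f and y to the nodal normal form. -/

section

variable {K : Type*} [Field K] {n : ℕ}

/-- The symmetric form of the quadric `∂f/∂y`, where `y` is the linear form of `v`. -/
def polarForm (f : MvPolynomial (Fin n) K) (v : Fin n → K) : LinearMap.BilinForm K (Fin n → K) :=
  LinearMap.mk₂ K (fun a b => dualSocle f (linForm K n v * linForm K n a * linForm K n b))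
    (fun a a' b => by simp only [map_add, mul_add, add_mul])
    (fun c a b => by simp only [map_smul, mul_smul_comm, smul_mul_assoc])
    (fun a b b' => by simp only [map_add, mul_add])
    (fun c a b => by simp only [map_smul, mul_smul_comm])

theorem polarForm_apply (f : MvPolynomial (Fin n) K) (v a b : Fin n → K) :
    polarForm f v a b = dualSocle f (linForm K n v * linForm K n a * linForm K n b) := rfl

theorem polarForm_comm (f : MvPolynomial (Fin n) K) (v a b : Fin n → K) :
    polarForm f v a b = polarForm f v b a := by
  rw [polarForm_apply, polarForm_apply, mul_right_comm]

/-- The Hessian matrix whose rank is `quadricRank`. -/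
def hessMatrix (q : MvPolynomial (Fin n) K) : Matrix (Fin n) (Fin n) K :=
  Matrix.of fun i j : Fin n => constantCoeff (pderiv i (pderiv j q))

theorem hessMatrix_diffOp_apply (f : MvPolynomial (Fin n) K) (v : Fin n → K) (i j : Fin n) :
    hessMatrix (diffOp K (linForm K n v) f) i j =
      polarForm f v (Pi.single i 1) (Pi.single j 1) := by
  rw [hessMatrix, Matrix.of_apply, polarForm_apply, dualSocle_apply, linForm_single,
    linForm_single, mul_assoc, mul_comm, diffOp_mul_apply, diffOp_mul_apply, diffOp_X_apply,
    diffOp_X_apply]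

theorem hessMatrix_mulVec (f : MvPolynomial (Fin n) K) (v a : Fin n → K) (i : Fin n) :
    (hessMatrix (diffOp K (linForm K n v) f)).mulVec a i = polarForm f v (Pi.single i 1) a := by
  rw [Matrix.mulVec, dotProduct]
  conv_rhs => rw [pi_eq_sum_univ' a, map_sum]
  refine Finset.sum_congr rfl fun j _ => ?_
  rw [hessMatrix_diffOp_apply, map_smul, smul_eq_mul, mul_comm]

/-- The radical lies in the kernel of the Hessian of ∂f/∂y, which is at most a line by the rank
bound and contains v. -/
theorem exists_eq_smul_of_polarForm_eq_zero {f : MvPolynomial (Fin n) K} {v : Fin n → K}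
    (hv : v ≠ 0) (hvB : ∀ a, polarForm f v v a = 0)
    (hr : n - 1 ≤ quadricRank (diffOp K (linForm K n v) f)) {a : Fin n → K}
    (ha : ∀ b, polarForm f v a b = 0) : ∃ c : K, a = c • v := by
  set M := hessMatrix (diffOp K (linForm K n v) f) with hM
  have hrank : n - 1 ≤ Module.finrank K (LinearMap.range M.mulVecLin) := hr
  have hmem : ∀ a, (∀ b, polarForm f v a b = 0) → a ∈ LinearMap.ker M.mulVecLin := by
    intro a ha
    rw [LinearMap.mem_ker]
    ext i
    rw [Matrix.mulVecLin_apply, hM, hessMatrix_mulVec, polarForm_comm, ha]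
    rfl
  have hdim := LinearMap.finrank_range_add_finrank_ker M.mulVecLin
  rw [Module.finrank_fin_fun] at hdim
  have hv' : (⟨v, hmem v hvB⟩ : LinearMap.ker M.mulVecLin) ≠ 0 := fun h =>
    hv (congrArg Subtype.val h)
  have hpos : 0 < Module.finrank K (LinearMap.ker M.mulVecLin) :=
    Module.finrank_pos_iff_exists_ne_zero.mpr ⟨_, hv'⟩
  have hone : Module.finrank K (LinearMap.ker M.mulVecLin) = 1 := by omega
  obtain ⟨c, hc⟩ := (finrank_eq_one_iff_of_nonzero' _ hv').mp hone ⟨a, hmem a ha⟩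
  exact ⟨c, (congrArg Subtype.val hc).symm⟩

theorem aeval_mk_linForm (f : MvPolynomial (Fin n) K) (b : Module.Basis (Fin n) K (Fin n → K))
    (p : MvPolynomial (Fin n) K) :
    aeval (fun i => Ideal.Quotient.mk (inverseSystemIdeal f) (linForm K n (b i))) p =
      Ideal.Quotient.mk (inverseSystemIdeal f) (linEquiv b p) := by
  have : aeval (fun i => Ideal.Quotient.mk (inverseSystemIdeal f) (linForm K n (b i))) =
      (Ideal.Quotient.mkₐ K (inverseSystemIdeal f)).comp (linEquiv b).toAlgHom := by
    ext1 i
    simp [linEquiv_X]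
  rw [this]; rfl

/-- The hypothesis on `f` and `y` puts the inverse system algebra in nodal form. -/
theorem exists_isNodal [CharZero K] [IsAlgClosed K] {f : MvPolynomial (Fin n) K}
    (hf : f.IsHomogeneous 3) {v : Fin n → K} (hv : v ≠ 0)
    (hy : diffOp K (linForm K n v ^ 2) f = 0)
    (hr : n - 1 ≤ quadricRank (diffOp K (linForm K n v) f)) {o u l : Fin n}
    (hou : o ≠ u) (hol : o ≠ l) (hul : u ≠ l) :
    ∃ b : Module.Basis (Fin n) K (Fin n → K),
      IsNodal (fun i => Ideal.Quotient.mk (inverseSystemIdeal f) (linForm K n (b i)))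
        (quotientSocle f) o u l := by
  have hvB : ∀ a, polarForm f v v a = 0 := by
    intro a
    rw [polarForm_apply, ← pow_two, dualSocle_apply, mul_comm, diffOp_mul_apply, hy, map_zero,
      map_zero]
  obtain ⟨b, hb, hgram⟩ := exists_basis_nodalGram (polarForm_comm f v) hv hvB
    (fun a ha => exists_eq_smul_of_polarForm_eq_zero hv hvB hr ha) hou hol hul
  refine ⟨b, hou, hol, hul, ?_, ?_, ?_, ?_⟩
  · intro r
    obtain ⟨g, rfl⟩ := Ideal.Quotient.mk_surjective r
    exact ⟨(linEquiv b).symm g, by rw [aeval_mk_linForm, AlgEquiv.apply_symm_apply]⟩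
  -- If Λ(hg) = 0 for all h, every derivative of g(∂)f vanishes at the origin, so g(∂)f = 0.
  · intro r hr
    obtain ⟨g, rfl⟩ := Ideal.Quotient.mk_surjective r
    rw [Ideal.Quotient.eq_zero_iff_mem]
    refine eq_zero_of_constantCoeff_diffOp fun h => ?_
    have := hr (Ideal.Quotient.mk _ h)
    rwa [← map_mul, quotientSocle_mk, dualSocle_apply, diffOp_mul_apply] at this
  · intro p d hp hd
    rw [aeval_mk_linForm, quotientSocle_mk]
    refine dualSocle_eq_zero hf (d := d) ?_ hd
    have : (aeval (fun i => linForm K n (b i)) p).IsHomogeneous (1 * d) :=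
      hp.aeval _ fun i => isHomogeneous_linForm _
    rwa [one_mul] at this
  · intro i j
    rw [← hgram, polarForm_apply, hb, ← map_mul, ← map_mul, quotientSocle_mk]

theorem span_range_mk_linForm (f : MvPolynomial (Fin n) K)
    (b : Module.Basis (Fin n) K (Fin n → K)) :
    Submodule.span K (Set.range fun i =>
      Ideal.Quotient.mk (inverseSystemIdeal f) (linForm K n (b i))) =
        quotientGrading (inverseSystemIdeal f) 1 := by
  rw [quotientGrading, ← range_linForm, LinearMap.range_eq_map, ← b.span_eq, Submodule.map_span,
    Submodule.map_span, ← Set.range_comp, ← Set.range_comp]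
  rfl

theorem isGQuadratic_of_isNodal {f : MvPolynomial (Fin n) K}
    {b : Module.Basis (Fin n) K (Fin n → K)} {o u l : Fin n}
    (H : IsNodal (fun i => Ideal.Quotient.mk (inverseSystemIdeal f) (linForm K n (b i)))
      (quotientSocle f) o u l) : IsGQuadratic (inverseSystemIdeal f) := by
  obtain ⟨m, G, hG, hm⟩ := H.exists_isGroebnerBasis
  refine ⟨(linEquiv b).symm, m, G, fun i => ?_, hG, ?_⟩
  · rw [linEquiv_symm_X]
    exact isHomogeneous_linForm _
  · convert hm using 1
    ext g
    rw [RingHom.mem_ker, Ideal.mem_map_of_equiv, aeval_mk_linForm, Ideal.Quotient.eq_zero_iff_mem]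
    constructor
    · rintro ⟨x, hx, rfl⟩
      simpa using hx
    · intro h
      exact ⟨linEquiv b g, h, by simp⟩

end

/-! ### Elimination theory: cubics with a degenerate singular point. -/

section

theorem sum_coeff_monomial {A : Type*} [CommRing A] {n k : ℕ}
    [Fintype {d : Fin n →₀ ℕ // d.degree = k}] {p : MvPolynomial (Fin n) A}
    (hp : p.IsHomogeneous k) :
    ∑ d : {d : Fin n →₀ ℕ // d.degree = k}, monomial d.1 (coeff d.1 p) = p := by
  classical
  ext m
  rw [coeff_sum]
  simp only [coeff_monomial]
  by_cases hm : m.degree = k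
  · rw [Finset.sum_eq_single ⟨m, hm⟩]
    · simp
    · intro b _ hb
      exact if_neg fun h => hb (Subtype.ext h)
    · simp
  · rw [hp.coeff_eq_zero hm]
    refine Finset.sum_eq_zero fun d _ => if_neg ?_
    rintro rfl
    exact hm d.2

instance fintypeExponent (n k : ℕ) : Fintype {d : Fin n →₀ ℕ // d.degree = k} :=
  have : Finite {d : Fin n →₀ ℕ // d.degree = k} := by
    refine Finite.of_injective (fun d (i : Fin n) => (⟨d.1 i, ?_⟩ : Fin (k + 1)))
      fun a b h => ?_
    · rw [Nat.lt_succ_iff]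
      exact (Finsupp.le_degree i d.1).trans_eq d.2
    · ext i
      simpa using congrFun h i
  Fintype.ofFinite _

section NodeEqs

variable {A : Type*} [CommRing A] {n : ℕ}

/-- The forms which vanish at the singular points of the cubic `F` at which the Hessian matrix has
rank less than `n - 1`. -/
def nodeEqs (F : MvPolynomial (Fin n) A) : Fin n ⊕ (Fin n × Fin n) → MvPolynomial (Fin n) A :=
  Sum.elim (fun i => pderiv i F)
    fun p => (Matrix.of fun i j => pderiv i (pderiv j F)).adjugate p.1 p.2

/-- This lets the equations of a given cubic be obtained by specializing those of `universalCubic`.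
-/
theorem nodeEqs_map {B : Type*} [CommRing B] (φ : A →+* B) (F : MvPolynomial (Fin n) A)
    (i : Fin n ⊕ (Fin n × Fin n)) : nodeEqs (map φ F) i = map φ (nodeEqs F i) := by
  rcases i with i | ⟨i, j⟩
  · exact pderiv_map
  · have h := RingHom.map_adjugate (map φ : MvPolynomial (Fin n) A →+* MvPolynomial (Fin n) B)
      (Matrix.of fun i j => pderiv i (pderiv j F))
    have h2 := congrFun (congrFun h i) j
    simp only [nodeEqs, Sum.elim_inr]
    refine Eq.trans ?_ h2.symm
    congr 2
    ext1 k l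
    simp [pderiv_map]

theorem isHomogeneous_det {m : ℕ} {M : Matrix (Fin m) (Fin m) (MvPolynomial (Fin n) A)}
    (hM : ∀ i j, (M i j).IsHomogeneous 1) : M.det.IsHomogeneous m := by
  rw [Matrix.det_apply]
  refine IsHomogeneous.sum _ _ _ fun σ _ => ?_
  rw [← mem_homogeneousSubmodule]
  refine zsmul_mem ?_ _
  rw [mem_homogeneousSubmodule]
  have := IsHomogeneous.prod Finset.univ (fun i => M (σ i) i) (fun _ => 1) fun i _ => hM _ _
  simpa using this

theorem exists_isHomogeneous_nodeEqs {F : MvPolynomial (Fin n) A} (hF : F.IsHomogeneous 3)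
    (i : Fin n ⊕ (Fin n × Fin n)) : ∃ d, (nodeEqs F i).IsHomogeneous d := by
  rcases i with i | ⟨i, j⟩
  · exact ⟨2, hF.pderiv⟩
  · obtain _ | m := n
    · exact i.elim0
    refine ⟨m, ?_⟩
    simp only [nodeEqs, Sum.elim_inr]
    rw [Matrix.adjugate_fin_succ_eq_det_submatrix]
    have h1 : ((-1) ^ (j + i : ℕ) : MvPolynomial (Fin (m + 1)) A) = C ((-1) ^ (j + i : ℕ)) := by
      simp
    rw [h1]
    exact (isHomogeneous_det fun a b => hF.pderiv.pderiv).C_mul _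

end NodeEqs

variable {K : Type*} [Field K] {n : ℕ}

/-- The cubic has a singular point which is not an ordinary node. -/
def HasBadPoint (f : MvPolynomial (Fin n) K) : Prop :=
  ∃ v : Fin n → K, v ≠ 0 ∧ ∀ i, eval v (nodeEqs f i) = 0

/-- The universal cubic. -/
def universalCubic (K : Type*) [Field K] (n : ℕ) :
    MvPolynomial (Fin n) (MvPolynomial (CubicExponent n) K) :=
  ∑ d : CubicExponent n, monomial d.1 (X d)

theorem map_universalCubic {f : MvPolynomial (Fin n) K} (hf : f.IsHomogeneous 3) :
    map (eval (cubicCoeffs f)) (universalCubic K n) = f := by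
  conv_rhs => rw [← sum_coeff_monomial hf]
  rw [universalCubic, map_sum]
  refine Finset.sum_congr rfl fun d _ => ?_
  rw [map_monomial, eval_X]
  rfl

/-- Projective Nullstellensatz: the equations have no common zero besides possibly the origin. -/
theorem exists_pow_le_span_nodeEqs [IsAlgClosed K] {f : MvPolynomial (Fin n) K}
    (hf : ¬ HasBadPoint f) :
    ∃ k : ℕ, (Ideal.span (Set.range (X : Fin n → MvPolynomial (Fin n) K))) ^ k ≤
      Ideal.span (Set.range (nodeEqs f)) := by
  refine Ideal.exists_pow_le_of_le_radical_of_fg ?_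
    (Submodule.fg_span (Set.finite_range _))
  rw [← vanishingIdeal_zeroLocus_eq_radical (K := K), Ideal.span_le]
  rintro _ ⟨i, rfl⟩
  rw [SetLike.mem_coe, mem_vanishingIdeal_iff]
  intro x hx
  rw [aeval_X]
  by_contra hxi
  refine hf ⟨x, fun h => hxi (by rw [h]; rfl), fun j => ?_⟩
  have := hx _ (Ideal.subset_span ⟨j, rfl⟩)
  simpa [aeval_eq_eval] using this

theorem monomial_mem_span_X_pow (d : Fin n →₀ ℕ) :
    (monomial d (1 : K)) ∈ (Ideal.span (Set.range (X : Fin n → MvPolynomial (Fin n) K))) ^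
      d.degree := by
  rw [monomial_eq, C_1, one_mul, Finsupp.degree_eq_sum, Finsupp.prod_fintype _ _ (by simp),
    ← Finset.prod_pow_eq_pow_sum]
  exact Ideal.prod_mem_prod fun i _ =>
    Ideal.pow_mem_pow (Ideal.subset_span (Set.mem_range_self i)) _

theorem eval_homogeneousComponent_eq_zero {f g : MvPolynomial (Fin n) K} (hf : f.IsHomogeneous 3)
    {v : Fin n → K} (hv : ∀ i, eval v (nodeEqs f i) = 0)
    (hg : g ∈ Ideal.span (Set.range (nodeEqs f))) (k : ℕ) :
    eval v (homogeneousComponent k g) = 0 := by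
  let _ := gradedAlgebra (σ := Fin n) (R := K)
  have hI : (Ideal.span (Set.range (nodeEqs f))).IsHomogeneous
      (homogeneousSubmodule (Fin n) K) := by
    refine Ideal.homogeneous_span _ _ ?_
    rintro _ ⟨i, rfl⟩
    exact exists_isHomogeneous_nodeEqs hf i
  have hle : Ideal.span (Set.range (nodeEqs f)) ≤ RingHom.ker (eval v) := by
    rw [Ideal.span_le]
    rintro _ ⟨i, rfl⟩
    exact hv i
  exact hle (homogeneousComponent_mem_of_mem hI hg k)

/-- The cubics with a bad point form a Zariski closed set. -/
theorem exists_separating_polynomial [IsAlgClosed K] {f₁ : MvPolynomial (Fin n) K}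
    (hf₁ : f₁.IsHomogeneous 3) (h₁ : ¬ HasBadPoint f₁) :
    ∃ P : MvPolynomial (CubicExponent n) K, eval (cubicCoeffs f₁) P ≠ 0 ∧
      ∀ f : MvPolynomial (Fin n) K, f.IsHomogeneous 3 → HasBadPoint f →
        eval (cubicCoeffs f) P = 0 := by
  classical
  obtain ⟨k, hk⟩ := exists_pow_le_span_nodeEqs h₁
  have hmem : ∀ m : {d : Fin n →₀ ℕ // d.degree = k},
      ∃ h : Fin n ⊕ (Fin n × Fin n) → MvPolynomial (Fin n) K,
        ∑ i, h i * nodeEqs f₁ i = monomial m.1 1 := by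
    intro m
    have h := hk (m.2 ▸ monomial_mem_span_X_pow (K := K) m.1)
    exact Ideal.mem_span_range_iff_exists_fun.mp h
  choose h hh using hmem
  -- The multipliers h that express the degree k monomials for f₁ are kept while the cubic varies.
  -- The matrix is the identity at f₁; at a cubic with bad point v it kills the vector of degree k
  -- monomials evaluated at v.
  set M : Matrix {d : Fin n →₀ ℕ // d.degree = k} {d : Fin n →₀ ℕ // d.degree = k}
      (MvPolynomial (CubicExponent n) K) := Matrix.of fun m m' =>
    coeff m'.1 (∑ i, map C (h m i) * nodeEqs (universalCubic K n) i) with hM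
  have hMf : ∀ f : MvPolynomial (Fin n) K, f.IsHomogeneous 3 →
      eval (cubicCoeffs f) M.det =
        (Matrix.of fun m m' : {d : Fin n →₀ ℕ // d.degree = k} =>
          coeff m'.1 (∑ i, h m i * nodeEqs f i)).det := by
    intro f hf
    rw [RingHom.map_det]
    congr 1
    ext m m'
    rw [RingHom.mapMatrix_apply, Matrix.map_apply, hM, Matrix.of_apply, Matrix.of_apply,
      ← coeff_map, map_sum]
    congr 1
    refine Finset.sum_congr rfl fun i _ => ?_
    rw [map_mul, ← nodeEqs_map, map_universalCubic hf, map_map]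
    have : (eval (cubicCoeffs f)).comp C = RingHom.id K := by
      ext x
      simp
    rw [this, map_id]
  refine ⟨M.det, ?_, fun f hf hbad => ?_⟩
  · rw [hMf f₁ hf₁]
    have : (Matrix.of fun m m' : {d : Fin n →₀ ℕ // d.degree = k} =>
        coeff m'.1 (∑ i, h m i * nodeEqs f₁ i)) = 1 := by
      ext m m'
      rw [Matrix.of_apply, hh, coeff_monomial, Matrix.one_apply]
      simp [Subtype.ext_iff]
    rw [this, Matrix.det_one]
    exact one_ne_zero
  · obtain ⟨v, hv, hbad⟩ := hbad
    rw [hMf f hf]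
    refine Matrix.exists_mulVec_eq_zero_iff.mp
      ⟨fun m => eval v (monomial m.1 (1 : K)), ?_, ?_⟩
    · obtain ⟨j, hj⟩ := Function.ne_iff.mp hv
      intro h0
      have := congrFun h0 ⟨Finsupp.single j k, Finsupp.degree_single _ _⟩
      simp only [eval_monomial, one_mul, Pi.zero_apply] at this
      rw [Finsupp.prod_single_index (h := fun n e => v n ^ e) (pow_zero _)] at this
      exact pow_ne_zero _ hj this
    · ext m
      rw [Matrix.mulVec, dotProduct, Pi.zero_apply]
      have hg : ∑ i, h m i * nodeEqs f i ∈ Ideal.span (Set.range (nodeEqs f)) :=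
        sum_mem fun i _ => Ideal.mul_mem_left _ _ (Ideal.subset_span ⟨i, rfl⟩)
      have h0 := eval_homogeneousComponent_eq_zero hf hbad hg k
      rw [← sum_coeff_monomial (homogeneousComponent_isHomogeneous k _), map_sum] at h0
      rw [← h0]
      refine Finset.sum_congr rfl fun m' _ => ?_
      rw [Matrix.of_apply, coeff_homogeneousComponent, if_pos m'.2, eval_monomial, eval_monomial,
        one_mul]

end

/-! ### An explicit cubic whose only singular point is a prescribed node. -/

section

variable {K : Type*} [Field K] {n : ℕ}

theorem pderiv_linForm (a : Fin n → K) (i : Fin n) : pderiv i (linForm K n a) = C (a i) := by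
  rw [linForm_apply, map_sum, Finset.sum_eq_single i]
  · rw [Derivation.map_smul, pderiv_X_self, smul_eq_C_mul, mul_one]
  · intro j _ hj
    rw [Derivation.map_smul, pderiv_X_of_ne hj, smul_zero]
  · simp

theorem eval_linForm (u a : Fin n → K) : eval u (linForm K n a) = a ⬝ᵥ u := by
  rw [linForm_apply, map_sum, dotProduct]
  simp [smul_eval]

/-- The cubic `∑ (ℓ_p ℓ_j² + ℓ_j³)` over `j ≠ p`, for the linear forms `ℓ_j` of the rows of `A`. -/
def nodalCubic (A : Matrix (Fin n) (Fin n) K) (p : Fin n) : MvPolynomial (Fin n) K :=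
  ∑ j ∈ Finset.univ.erase p,
    (linForm K n (A p) * linForm K n (A j) ^ 2 + linForm K n (A j) ^ 3)

theorem isHomogeneous_nodalCubic (A : Matrix (Fin n) (Fin n) K) (p : Fin n) :
    (nodalCubic A p).IsHomogeneous 3 := by
  refine IsHomogeneous.sum _ _ _ fun j _ => IsHomogeneous.add ?_ ?_
  · exact (isHomogeneous_linForm _).mul ((isHomogeneous_linForm _).pow 2)
  · exact (isHomogeneous_linForm _).pow 3

theorem pderiv_nodalCubic (A : Matrix (Fin n) (Fin n) K) (p i : Fin n) :
    pderiv i (nodalCubic A p) = ∑ j ∈ Finset.univ.erase p,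
      (C (A p i) * linForm K n (A j) ^ 2 + C (A j i) * (2 * linForm K n (A p) * linForm K n (A j) +
        3 * linForm K n (A j) ^ 2)) := by
  rw [nodalCubic, map_sum]
  refine Finset.sum_congr rfl fun j _ => ?_
  simp only [map_add, pderiv_mul, pderiv_pow, pderiv_linForm]
  push_cast
  ring

/-- Chain rule: the gradient of x_p ∑ x_j² + ∑ x_j³ at A u, pulled back by the transpose of A. -/
theorem eval_pderiv_nodalCubic (A : Matrix (Fin n) (Fin n) K) (p i : Fin n) (u : Fin n → K) :
    eval u (pderiv i (nodalCubic A p)) = (A.transpose.mulVec fun j =>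
      if j = p then ∑ k ∈ Finset.univ.erase p, (A.mulVec u k) ^ 2
      else 2 * A.mulVec u p * A.mulVec u j + 3 * A.mulVec u j ^ 2) i := by
  rw [pderiv_nodalCubic, Matrix.mulVec, dotProduct, ← Finset.add_sum_erase _ _ (Finset.mem_univ p),
    if_pos rfl, map_sum, Finset.mul_sum, ← Finset.sum_add_distrib]
  refine Finset.sum_congr rfl fun j hj => ?_
  rw [if_neg (Finset.ne_of_mem_erase hj)]
  simp only [map_add, map_mul, map_pow, eval_C, eval_linForm, Matrix.transpose_apply,
    Matrix.mulVec, map_ofNat]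

theorem eval_hessian_nodalCubic (A : Matrix (Fin n) (Fin n) K) (p : Fin n) {u : Fin n → K}
    (hu : ∀ j, j ≠ p → A.mulVec u j = 0) :
    (Matrix.of fun i k => eval u (pderiv i (pderiv k (nodalCubic A p)))) =
      A.transpose * Matrix.diagonal (fun j => if j = p then 0 else 2 * A.mulVec u p) * A := by
  ext i k
  rw [Matrix.of_apply, pderiv_nodalCubic, Matrix.mul_apply,
    ← Finset.add_sum_erase _ _ (Finset.mem_univ p), Matrix.mul_diagonal, if_pos rfl, mul_zero,
    zero_mul, zero_add, map_sum, map_sum]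
  refine Finset.sum_congr rfl fun j hj => ?_
  have hj' := Finset.ne_of_mem_erase hj
  have h0 : A j ⬝ᵥ u = 0 := hu j hj'
  rw [Matrix.mul_diagonal, if_neg hj', Matrix.transpose_apply]
  have h2 : pderiv i (2 : MvPolynomial (Fin n) K) = 0 := by
    rw [← map_ofNat C 2, pderiv_C]
  have h3 : pderiv i (3 : MvPolynomial (Fin n) K) = 0 := by
    rw [← map_ofNat C 3, pderiv_C]
  simp only [map_add, pderiv_mul, pderiv_pow, pderiv_linForm, pderiv_C, h2, h3, map_mul, map_pow,
    eval_C, eval_linForm, h0, map_ofNat, map_zero, Matrix.mulVec]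
  ring

/-- Each s j is 0 or -2 s p / 3, so the sum of squares is the number of nonzero s j times (2 s p /
3)². In characteristic 0 either that number or s p is zero. -/
theorem eq_zero_of_nodal_equations [CharZero K] {p : Fin n} {s : Fin n → K}
    (hp : ∑ k ∈ Finset.univ.erase p, s k ^ 2 = 0)
    (hs : ∀ j, j ≠ p → 2 * s p * s j + 3 * s j ^ 2 = 0) : ∀ j, j ≠ p → s j = 0 := by
  classical
  have h3 : (3 : K) ≠ 0 := three_ne_zero
  have hsq : ∀ k ∈ Finset.univ.erase p, s k ^ 2 = if s k = 0 then 0 else (2 * s p / 3) ^ 2 := by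
    intro k hk
    split_ifs with h
    · rw [h]; ring
    · have h1 : s k * (2 * s p + 3 * s k) = 0 := by
        linear_combination hs k (Finset.ne_of_mem_erase hk)
      have h2 := (mul_eq_zero.mp h1).resolve_left h
      have : s k = -(2 * s p / 3) := by
        field_simp
        linear_combination h2
      rw [this]; ring
  rw [Finset.sum_congr rfl hsq, Finset.sum_ite, Finset.sum_const_zero, zero_add, Finset.sum_const,
    nsmul_eq_mul, mul_eq_zero] at hp
  intro j hj
  by_contra h
  rcases hp with hp | hp
  · rw [Nat.cast_eq_zero, Finset.card_eq_zero] at hp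
    exact Finset.notMem_empty j (hp ▸ Finset.mem_filter.mpr
      ⟨Finset.mem_erase.mpr ⟨hj, Finset.mem_univ _⟩, h⟩)
  · have := hsq j (Finset.mem_erase.mpr ⟨hj, Finset.mem_univ _⟩)
    rw [if_neg h, hp] at this
    exact h (pow_eq_zero_iff two_ne_zero |>.mp this)

theorem adjugate_eval_hessian (F : MvPolynomial (Fin n) K) (u : Fin n → K) (i j : Fin n) :
    (Matrix.of fun i k => eval u (pderiv i (pderiv k F))).adjugate i j =
      eval u (nodeEqs F (Sum.inr (i, j))) := by
  have h1 := RingHom.map_adjugate (eval u) (Matrix.of fun i j => pderiv i (pderiv j F))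
  exact (congrFun (congrFun h1 i) j).symm

theorem adjugate_eq_zero_of_conj {A D : Matrix (Fin n) (Fin n) K} (hA : IsUnit A.det)
    (h : (A.transpose * D * A).adjugate = 0) : D.adjugate = 0 := by
  rw [Matrix.adjugate_mul_distrib, Matrix.adjugate_mul_distrib] at h
  have h2 : A * (A.adjugate * (D.adjugate * A.transpose.adjugate)) * A.transpose = 0 := by
    rw [h, Matrix.mul_zero, Matrix.zero_mul]
  rw [← Matrix.mul_assoc, Matrix.mul_adjugate, Matrix.smul_mul, Matrix.one_mul, Matrix.smul_mul,
    Matrix.mul_assoc, Matrix.adjugate_mul, Matrix.mul_smul, Matrix.mul_one, Matrix.det_transpose,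
    smul_eq_zero_iff_right hA.ne_zero, smul_eq_zero_iff_right hA.ne_zero] at h2
  exact h2

/-- At a singular point all ℓ_j with j ≠ p vanish and ℓ_p does not. There the Hessian is congruent
to a diagonal matrix with entry 0 at p and 2 ℓ_p elsewhere, whose adjugate is nonzero at (p, p). -/
theorem not_hasBadPoint_nodalCubic [CharZero K] {A : Matrix (Fin n) (Fin n) K} (p : Fin n)
    (hA : IsUnit A.det) : ¬ HasBadPoint (nodalCubic A p) := by
  rintro ⟨u, hu, h⟩
  have hinj : ∀ z : Fin n → K, A.transpose.mulVec z = 0 → z = 0 := by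
    intro z hz
    by_contra hz0
    have := Matrix.exists_mulVec_eq_zero_iff.mp ⟨z, hz0, hz⟩
    rw [Matrix.det_transpose] at this
    exact hA.ne_zero this
  have hsing : ∀ i, eval u (pderiv i (nodalCubic A p)) = 0 := fun i => by
    simpa only [nodeEqs, Sum.elim_inl] using h (Sum.inl i)
  have hg : (fun j => if j = p then ∑ k ∈ Finset.univ.erase p, (A.mulVec u k) ^ 2
      else 2 * A.mulVec u p * A.mulVec u j + 3 * A.mulVec u j ^ 2) = 0 := by
    apply hinj
    funext i
    rw [← eval_pderiv_nodalCubic, hsing, Pi.zero_apply]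
  have hs : ∀ j, j ≠ p → A.mulVec u j = 0 := by
    refine eq_zero_of_nodal_equations ?_ fun j hj => ?_
    · simpa only [if_pos, Pi.zero_apply] using congrFun hg p
    · simpa only [if_neg hj, Pi.zero_apply] using congrFun hg j
  have hp : A.mulVec u p ≠ 0 := by
    intro hp
    apply hA.ne_zero
    refine Matrix.exists_mulVec_eq_zero_iff.mp ⟨u, hu, funext fun j => ?_⟩
    by_cases hj : j = p
    · rw [hj, hp, Pi.zero_apply]
    · rw [hs j hj, Pi.zero_apply]
  have hadj : (Matrix.of fun i k => eval u (pderiv i (pderiv k (nodalCubic A p)))).adjugate = 0 := by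
    ext i j
    rw [adjugate_eval_hessian]
    exact h (Sum.inr (i, j))
  rw [eval_hessian_nodalCubic A p hs] at hadj
  have h3 := congrFun (congrFun (adjugate_eq_zero_of_conj hA hadj) p) p
  rw [Matrix.adjugate_diagonal, Matrix.diagonal_apply_eq, Matrix.zero_apply,
    Finset.prod_eq_zero_iff] at h3
  obtain ⟨j, hj, h3⟩ := h3
  rw [if_neg (Finset.ne_of_mem_erase hj)] at h3
  exact mul_ne_zero two_ne_zero hp h3

theorem exists_mulVec_eq_zero_of_ne {v : Fin n → K} {p : Fin n} (hp : v p ≠ 0) :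
    ∃ A : Matrix (Fin n) (Fin n) K, IsUnit A.det ∧ ∀ j, j ≠ p → A.mulVec v j = 0 := by
  -- The transvection x ↦ x - x_p b sends v to v p times the p-th unit vector; b p = 0 makes it
  -- invertible.
  set b : Fin n → K := (v p)⁻¹ • v - Pi.single p 1 with hb
  have hbp : b p = 0 := by simp [hb, hp]
  set N := Matrix.vecMulVec b (Pi.single p (1 : K)) with hN
  have hNN : N * N = 0 := by
    rw [hN, Matrix.vecMulVec_mul_vecMulVec]
    simp [hbp]
  refine ⟨1 - N, ?_, fun j hj => ?_⟩
  · have : (1 - N) * (1 + N) = 1 := by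
      rw [mul_add, sub_mul, sub_mul, hNN]
      simp
    exact Matrix.isUnit_det_of_right_inverse this
  · rw [Matrix.sub_mulVec, Matrix.one_mulVec, Pi.sub_apply, hN, Matrix.vecMulVec_mulVec]
    simp [hb, hj, hp, mul_comm]

/-- Every point is a singular point of a cubic all of whose singular points are nodes. -/
theorem exists_nodal_cubic [CharZero K] {v : Fin n → K} (hv : v ≠ 0) :
    ∃ f : MvPolynomial (Fin n) K, f.IsHomogeneous 3 ∧ ¬ HasBadPoint f ∧ eval v f = 0 ∧
      ∀ i, eval v (pderiv i f) = 0 := by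
  obtain ⟨p, hp⟩ := Function.ne_iff.mp hv
  obtain ⟨A, hA, hAv⟩ := exists_mulVec_eq_zero_of_ne hp
  refine ⟨nodalCubic A p, isHomogeneous_nodalCubic A p, not_hasBadPoint_nodalCubic p hA, ?_, ?_⟩
  · rw [nodalCubic, map_sum]
    refine Finset.sum_eq_zero fun j hj => ?_
    have h0 : A j ⬝ᵥ v = 0 := hAv j (Finset.ne_of_mem_erase hj)
    simp [eval_linForm, h0]
  · intro i
    rw [pderiv_nodalCubic, map_sum]
    refine Finset.sum_eq_zero fun j hj => ?_
    have h0 : A j ⬝ᵥ v = 0 := hAv j (Finset.ne_of_mem_erase hj)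
    simp [eval_linForm, h0]

end

/-! ### Singular points as linear forms, density, and the two claims. -/

section

variable {K : Type*} [Field K] {n : ℕ}

theorem diffOp_linForm_apply (v : Fin n → K) (p : MvPolynomial (Fin n) K) :
    diffOp K (linForm K n v) p = ∑ i, v i • pderiv i p := by
  rw [linForm_apply, map_sum, LinearMap.sum_apply]
  refine Finset.sum_congr rfl fun i _ => ?_
  rw [map_smul, LinearMap.smul_apply, diffOp_X_apply]

theorem isHomogeneous_diffOp_linForm (v : Fin n → K) {p : MvPolynomial (Fin n) K} {k : ℕ}
    (hp : p.IsHomogeneous k) : (diffOp K (linForm K n v) p).IsHomogeneous (k - 1) := by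
  rw [diffOp_linForm_apply]
  refine IsHomogeneous.sum _ _ _ fun i _ => ?_
  rw [smul_eq_C_mul]
  exact hp.pderiv.C_mul _

theorem eval_diffOp_linForm (v : Fin n → K) {p : MvPolynomial (Fin n) K} {k : ℕ}
    (hp : p.IsHomogeneous k) : eval v (diffOp K (linForm K n v) p) = k * eval v p := by
  have h := congrArg (eval v) hp.sum_X_mul_pderiv
  rw [diffOp_linForm_apply, map_sum]
  rw [map_sum, nsmul_eq_mul, map_mul, map_natCast] at h
  rw [← h]
  refine Finset.sum_congr rfl fun i _ => ?_
  rw [smul_eval, map_mul, eval_X]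

theorem eval_eq_constantCoeff (v : Fin n → K) {p : MvPolynomial (Fin n) K}
    (hp : p.IsHomogeneous 0) : eval v p = constantCoeff p := by
  rw [← totalDegree_zero_iff_isHomogeneous, totalDegree_eq_zero_iff_eq_C] at hp
  rw [hp]
  simp

theorem pderiv_diffOp (g p : MvPolynomial (Fin n) K) (i : Fin n) :
    pderiv i (diffOp K g p) = diffOp K g (pderiv i p) := by
  rw [← diffOp_X_apply, ← diffOp_X_apply, ← diffOp_mul_apply, ← diffOp_mul_apply, mul_comm]

/-- The i-th coefficient of the linear form ∂²f/∂y² is ∂²(∂f/∂x_i)/∂y², which by Euler's identity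
used twice is 2 (∂f/∂x_i)(v). -/
theorem diffOp_sq_eq_zero_of_singular {f : MvPolynomial (Fin n) K} (hf : f.IsHomogeneous 3)
    {v : Fin n → K} (hv : ∀ i, eval v (pderiv i f) = 0) :
    diffOp K (linForm K n v ^ 2) f = 0 := by
  have hg : (diffOp K (linForm K n v ^ 2) f).IsHomogeneous 1 := by
    rw [pow_two, diffOp_mul_apply]
    exact isHomogeneous_diffOp_linForm v (isHomogeneous_diffOp_linForm v hf)
  have h := hg.sum_X_mul_pderiv
  rw [one_smul] at h
  rw [← h]
  refine Finset.sum_eq_zero fun i _ => ?_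
  have hq : (pderiv i f).IsHomogeneous 2 := hf.pderiv
  have hD := isHomogeneous_diffOp_linForm v hq
  have h0 : eval v (diffOp K (linForm K n v) (diffOp K (linForm K n v) (pderiv i f))) = 0 := by
    rw [eval_diffOp_linForm v hD, eval_diffOp_linForm v hq, hv, mul_zero, mul_zero]
  have hDD := isHomogeneous_diffOp_linForm v hD
  rw [pderiv_diffOp, pow_two, diffOp_mul_apply]
  rw [eval_eq_constantCoeff v hDD] at h0
  rw [← totalDegree_zero_iff_isHomogeneous, totalDegree_eq_zero_iff_eq_C] at hDD
  rw [hDD, ← constantCoeff_eq, h0, C_0, mul_zero]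

theorem hessMatrix_diffOp_eq_eval {f : MvPolynomial (Fin n) K} (hf : f.IsHomogeneous 3)
    (v : Fin n → K) : hessMatrix (diffOp K (linForm K n v) f) =
      Matrix.of fun i j => eval v (pderiv i (pderiv j f)) := by
  ext i j
  have hp : (pderiv i (pderiv j f)).IsHomogeneous 1 := hf.pderiv.pderiv
  rw [hessMatrix, Matrix.of_apply, Matrix.of_apply, pderiv_diffOp, pderiv_diffOp,
    ← eval_eq_constantCoeff v (isHomogeneous_diffOp_linForm v hp), eval_diffOp_linForm v hp,
    Nat.cast_one, one_mul]

theorem rank_add_le (A B : Matrix (Fin n) (Fin n) K) : (A + B).rank ≤ A.rank + B.rank := by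
  refine le_trans (Submodule.finrank_mono ?_) (Submodule.finrank_add_le_finrank_add_finrank
    (LinearMap.range A.mulVecLin) (LinearMap.range B.mulVecLin))
  rintro _ ⟨x, rfl⟩
  rw [Matrix.mulVecLin_add]
  exact Submodule.add_mem_sup ⟨x, rfl⟩ ⟨x, rfl⟩

/-- An adjugate entry is the determinant of A with one row replaced, and this replacement changes
the rank by at most one. -/
theorem le_rank_of_adjugate_ne_zero {A : Matrix (Fin n) (Fin n) K} {i j : Fin n}
    (h : A.adjugate i j ≠ 0) : n - 1 ≤ A.rank := by
  rw [Matrix.adjugate_apply] at h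
  have h1 : A.updateRow j (Pi.single i 1) =
      A + Matrix.vecMulVec (Pi.single j 1) (Pi.single i 1 - A j) := by
    ext a b
    by_cases ha : a = j
    · subst ha
      simp [Matrix.vecMulVec_apply]
    · simp [Matrix.vecMulVec_apply, ha]
  have h2 := Matrix.rank_of_isUnit _ ((Matrix.isUnit_iff_isUnit_det _).mpr
    (isUnit_iff_ne_zero.mpr h))
  have h3 := rank_add_le A (Matrix.vecMulVec (Pi.single j 1) (Pi.single i 1 - A j))
  have h4 := Matrix.rank_vecMulVec_le (Pi.single j (1 : K)) (Pi.single i 1 - A j)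
  rw [h1, Fintype.card_fin] at h2
  omega

/-- A singular cubic without bad points is G-quadratic. -/
theorem isGQuadratic_of_not_hasBadPoint [CharZero K] [IsAlgClosed K] (hn : 3 ≤ n)
    {f : MvPolynomial (Fin n) K} (hf : IsSingularCubic f) (h : ¬ HasBadPoint f) :
    IsGQuadratic (inverseSystemIdeal f) := by
  obtain ⟨hf3, _, v, hv, _, hvf⟩ := hf
  have hex : ∃ i, eval v (nodeEqs f i) ≠ 0 := by
    by_contra hall
    push Not at hall
    exact h ⟨v, hv, hall⟩
  obtain ⟨i | ⟨i, j⟩, hij⟩ := hex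
  · exact absurd (hvf i) hij
  rw [← adjugate_eval_hessian, ← hessMatrix_diffOp_eq_eval hf3] at hij
  obtain ⟨b, H⟩ := exists_isNodal hf3 hv (diffOp_sq_eq_zero_of_singular hf3 hvf)
    (le_rank_of_adjugate_ne_zero hij) (o := ⟨0, by omega⟩) (u := ⟨1, by omega⟩)
    (l := ⟨2, by omega⟩) (by simp) (by simp) (by simp)
  exact isGQuadratic_of_isNodal H

/-- A polynomial which vanishes on the part of a line where `P` does not vanish vanishes on the
whole line, unless `P` vanishes on it. -/
theorem eval_eq_zero_of_line {σ : Type*} [Infinite K] {P w : MvPolynomial σ K} {c c₁ : σ → K}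
    (hP : eval c₁ P ≠ 0)
    (h : ∀ t : K, eval (c + t • (c₁ - c)) P ≠ 0 → eval (c + t • (c₁ - c)) w = 0) :
    eval c w = 0 := by
  set line : MvPolynomial σ K →ₐ[K] Polynomial K :=
    aeval fun d => Polynomial.C (c d) + Polynomial.X * Polynomial.C (c₁ d - c d) with hline
  have heval : ∀ (t : K) (Q : MvPolynomial σ K),
      (line Q).eval t = eval (c + t • (c₁ - c)) Q := by
    intro t Q
    have : (Polynomial.aeval t).comp line = aeval (c + t • (c₁ - c)) := by
      ext1 d
      simp [hline]
    have h2 := DFunLike.congr_fun this Q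
    rw [AlgHom.comp_apply, Polynomial.coe_aeval_eq_eval] at h2
    rw [h2, aeval_eq_eval]
  -- On the line P * w vanishes at every t; K is infinite, K[t] is a domain, and P is nonzero at t =
  -- 1.
  have hmul : line P * line w = 0 := by
    refine Polynomial.funext fun t => ?_
    rw [Polynomial.eval_mul, heval, heval, Polynomial.eval_zero]
    by_cases hPt : eval (c + t • (c₁ - c)) P = 0
    · rw [hPt, zero_mul]
    · rw [h t hPt, mul_zero]
  have hline0 : line P ≠ 0 := by
    intro h0
    have := heval 1 P
    rw [h0, Polynomial.eval_zero, one_smul, add_sub_cancel] at this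
    exact hP this.symm
  have hw := (mul_eq_zero.mp hmul).resolve_left hline0
  have := heval 0 w
  rw [hw, Polynomial.eval_zero, zero_smul, add_zero] at this
  exact this.symm

/-- This ensures that a member of the joining line at which P is nonzero is a nonzero cubic. -/
theorem hasBadPoint_zero (hn : 3 ≤ n) : HasBadPoint (0 : MvPolynomial (Fin n) K) := by
  refine ⟨fun _ => 1, fun h => one_ne_zero (congrFun h ⟨0, by omega⟩), ?_⟩
  rintro (i | ⟨i, j⟩)
  · simp [nodeEqs]
  · rw [← adjugate_eval_hessian]
    by_contra h
    have := le_rank_of_adjugate_ne_zero h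
    have h0 : (Matrix.of fun i k : Fin n => eval (fun _ => (1 : K))
        (pderiv i (pderiv k (0 : MvPolynomial (Fin n) K)))) = 0 := by
      ext; simp
    rw [h0, Matrix.rank_zero] at this
    omega

theorem forGenericSingularCubic_isGQuadratic [CharZero K] [IsAlgClosed K] (hn : 3 ≤ n) :
    ForGenericSingularCubic
      (fun f : MvPolynomial (Fin n) K => IsGQuadratic (inverseSystemIdeal f)) := by
  have hZ : ∀ f : MvPolynomial (Fin n) K, ∀ P : MvPolynomial _ K,
      (∀ g : MvPolynomial (Fin n) K, g.IsHomogeneous 3 → HasBadPoint g →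
        eval (cubicCoeffs g) P = 0) → eval (cubicCoeffs f) P ≠ 0 →
      cubicCoeffs f ∉ zeroLocus K (vanishingIdeal K
        {c : CubicExponent n → K | ∃ g, g.IsHomogeneous 3 ∧ HasBadPoint g ∧ cubicCoeffs g = c}) := by
    intro f P hP hPf hmem
    have := hmem P (by
      rintro _ ⟨g, hg, hbad, rfl⟩
      rw [aeval_eq_eval]
      exact hP g hg hbad)
    rw [aeval_eq_eval] at this
    exact hPf this
  refine ⟨vanishingIdeal K
      {c : CubicExponent n → K | ∃ g, g.IsHomogeneous 3 ∧ HasBadPoint g ∧ cubicCoeffs g = c},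
    fun f hf hfZ => isGQuadratic_of_not_hasBadPoint hn hf fun hbad => hfZ ?_, ?_⟩
  · exact zeroLocus_vanishingIdeal_le _ ⟨f, hf.1, hbad, rfl⟩
  · intro W hW f hf w hw
    obtain ⟨hf3, -, v, hv, hvf, hvd⟩ := hf
    -- Taking f₁ singular at the same point v keeps the whole line from f to f₁ singular at v.
    obtain ⟨f₁, hf₁, hgood, hvf₁, hvd₁⟩ := exists_nodal_cubic hv
    obtain ⟨P, hP₁, hP⟩ := exists_separating_polynomial hf₁ hgood
    rw [aeval_eq_eval]
    refine eval_eq_zero_of_line hP₁ fun t ht => ?_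
    have hc : cubicCoeffs f + t • (cubicCoeffs f₁ - cubicCoeffs f) =
        cubicCoeffs (f + t • (f₁ - f)) := by
      ext d
      simp [cubicCoeffs]
    rw [hc] at ht ⊢
    have hhom : (f + t • (f₁ - f)).IsHomogeneous 3 := by
      rw [smul_eq_C_mul]
      exact hf3.add ((hf₁.sub hf3).C_mul _)
    have hne : f + t • (f₁ - f) ≠ 0 := by
      intro h0
      rw [h0] at ht
      exact ht (hP 0 (isHomogeneous_zero _ _ _) (hasBadPoint_zero hn))
    have hsing : IsSingularCubic (f + t • (f₁ - f)) :=
      ⟨hhom, hne, v, hv, by simp [smul_eval, hvf, hvf₁], fun i => by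
        simp [smul_eval, hvd, hvd₁]⟩
    have := hW _ hsing (hZ _ P hP ht) w hw
    rwa [aeval_eq_eval] at this

theorem hasGroebnerFlag_of_quadricRank [CharZero K] [IsAlgClosed K] (hn : 3 ≤ n)
    {f y : MvPolynomial (Fin n) K} (hf : f.IsHomogeneous 3) (hy : y.IsHomogeneous 1)
    (hyf : diffOp K (y ^ 2) f = 0) (hr : quadricRank (diffOp K y f) = n - 1) :
    HasGroebnerFlag (quotientGrading (inverseSystemIdeal f) 1) := by
  rw [← mem_homogeneousSubmodule, ← range_linForm] at hy
  obtain ⟨v, rfl⟩ := hy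
  -- For y = 0 the Hessian would have rank 0, whereas n - 1 ≥ 2.
  have hv : v ≠ 0 := by
    rintro rfl
    have h0 : quadricRank (diffOp K (linForm K n 0) f) = (0 : Matrix (Fin n) (Fin n) K).rank := by
      rw [quadricRank]
      congr 1
      ext i j
      simp
    rw [h0, Matrix.rank_zero] at hr
    omega
  obtain ⟨b, H⟩ := exists_isNodal hf hv hyf hr.ge (o := ⟨0, by omega⟩) (u := ⟨1, by omega⟩)
    (l := ⟨n - 1, by omega⟩) (by simp) (by simp; omega) (by simp; omega)
  rw [← span_range_mk_linForm f b]
  exact H.hasGroebnerFlag rfl rfl (by simp; omega)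

end

end CubicInverseSystem

end

theorem mainTheorem6 (K : Type*) [Field K] [CharZero K] [IsAlgClosed K] (n : ℕ) (hn : 3 ≤ n) :
    (∀ f y : MvPolynomial (Fin n) K, f.IsHomogeneous 3 → y.IsHomogeneous 1 →
      CubicInverseSystem.diffOp K (y ^ 2) f = 0 →
      CubicInverseSystem.quadricRank (CubicInverseSystem.diffOp K y f) = n - 1 →
      CubicInverseSystem.HasGroebnerFlag
        (CubicInverseSystem.quotientGrading (CubicInverseSystem.inverseSystemIdeal f) 1)) ∧
    CubicInverseSystem.ForGenericSingularCubic
      (fun f : MvPolynomial (Fin n) K =>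
        CubicInverseSystem.IsGQuadratic (CubicInverseSystem.inverseSystemIdeal f)) :=
  ⟨fun _ _ hf hy hyf hr => CubicInverseSystem.hasGroebnerFlag_of_quadricRank hn hf hy hyf hr,
    CubicInverseSystem.forGenericSingularCubic_isGQuadratic hn⟩
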